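/- Let $F$ be a field of arbitrary characteristic and $n\ge 0$. A $\Gamma$-algebra over $F$ is a unital (not necessarily associative) $\mathbb Z_2$-graded $F$-algebra $\Gamma=\Gamma_0\oplus\Gamma_1$, $1\in\Gamma_0$, such that (i) $\Gamma_0$ is associative and $[\Gamma_0,\Gamma_1]=(\Gamma_0,\Gamma,\Gamma)=0$; (ii) $\Gamma_1^2\subseteq Z(\Gamma_0)$; (iii) the product on $\Gamma_1$ is skew-symmetric, i.e. $xy+yx=0$ and $x^2=0$ for $x,y\in\Gamma_1$ (the second condition follows from the first if $\operatorname{char}F\ne 2$); (iv) $(xy)z+(yz)x+(zx)y=0$ for $x,y,z\in\Gamma_1$. For a commutative associative unital $F$-algebra $A$, let $\Gamma(A)=A\oplus A^2$, with even part $A$, odd part $A^2$, and product extending that of $A$ by $a\cdot(b,c)=(b,c)\cdot a=(ab,ac)$ and $(a,b)\cdot(c,d)=ad-bc$. For a vector space $W$ over $F$, let $F[Gr(2,W)]=F[W^{\wedge 2}]/P$, where $F[W^{\wedge 2}]$ is the symmetric (polynomial) algebra of $W^{\wedge 2}$ and $P$ is the ideal generated by all $(u\wedge v)(w\wedge z)+(u\wedge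 w)(z\wedge v)+(u\wedge z)(v\wedge w)$. Let $F[Gr(2,W)]_1$ be the quotient of the $F[Gr(2,W)]$-module $F[Gr(2,W)]\otimes W$ by the submodule generated by all $(u\wedge v)\otimes w+(v\wedge w)\otimes u+(w\wedge u)\otimes v$. Let $\Gamma[\emptyset;W]=F[Gr(2,W)]\oplus F[Gr(2,W)]_1$, with the products of $F[Gr(2,W)]$ with itself and with its (commutative) bimodule $F[Gr(2,W)]_1$, and $(a\otimes u)(b\otimes v)=ab\,(u\wedge v)$. Let $A_n=F[x_1,\dots,x_n,y_1,\dots,y_n]$, let $v_i=(x_i,y_i)\in A_n^2$ be regarded as odd elements of $\Gamma(A_n)$, let $V=\sum_i Fv_i$, let $\alpha_{ij}=v_iv_j=x_iy_j-x_jy_i$, and let $S_n=F[\alpha_{ij}\mid i<j]\subseteq A_n$. Let $B_n$ be the family of standard monomials $\alpha_{i_1j_1}\cdots\alpha_{i_rj_r}$ with $r\ge 0$, $i_s<j_s$ for all $s$, $i_1\le\dots\le i_r$ and $j_1\le\dots\le j_r$, and let $B_{n,m}\subseteq B_n$ consist of those with $r=0$ or $j_1\ge m$. Theorem. The space $S_n+S_nV$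 is a subalgebra of $\Gamma(A_n)$, namely the unital subalgebra generated by $v_1,\dots,v_n$. It is isomorphic, as a graded unital algebra and by an isomorphism matching the standard basis $e_1,\dots,e_n$ of $F^n$ with $v_1,\dots,v_n$, to $\Gamma[\emptyset;F^n]$, which is the free $\Gamma$-algebra on the space $F^n$ of odd generators: every linear map from $F^n$ to the odd part of a $\Gamma$-algebra extends uniquely to a homomorphism of unital algebras, and that homomorphism respects the gradings. The elements of $B_n\cup\bigcup_{j=1}^n B_{n,j}v_j$, indexed by the index sequences of the standard monomials and, for the odd ones, also by $j$, form a basis of $S_n+S_nV$ over $F$. -/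

import Mathlib

universe w u v t

noncomputable section

/-! ### `Γ`-algebras -/

/-- Let `G` be a (not necessarily associative) unital algebra over `F`. The subspaces `even = G₀` and
`odd = G₁` make it a `Γ`-algebra: `G = G₀ ⊕ G₁` is a `ℤ/2`-grading with `1 ∈ G₀`, and
(i) `G₀` is associative and `[G₀, G₁] = (G₀, G, G) = 0`, (ii) `G₁² ⊆ Z(G₀)`, (iii) the product of odd
elements is skew-symmetric, (iv) `(xy)z + (yz)x + (zx)y = 0` for odd `x, y, z`. -/
structure IsGammaAlgebra {F G : Type*} [Field F] [NonAssocRing G] [Module F G]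
    [IsScalarTower F G G] [SMulCommClass F G G] (even odd : Submodule F G) : Prop where
  isCompl : IsCompl even odd
  one_mem : (1 : G) ∈ even
  even_mul_even : ∀ a ∈ even, ∀ b ∈ even, a * b ∈ even
  even_mul_odd : ∀ a ∈ even, ∀ x ∈ odd, a * x ∈ odd
  odd_mul_even : ∀ x ∈ odd, ∀ a ∈ even, x * a ∈ odd
  odd_mul_odd : ∀ x ∈ odd, ∀ y ∈ odd, x * y ∈ even
  /-- `(G₀, G, G) = 0`; in particular `G₀` is associative. -/
  even_assoc : ∀ a ∈ even, ∀ g h : G, (a * g) * h = a * (g * h)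
  /-- `[G₀, G₁] = 0`. -/
  even_comm_odd : ∀ a ∈ even, ∀ x ∈ odd, a * x = x * a
  /-- `G₁²` commutes with the associative algebra `G₀`. -/
  odd_mul_odd_comm : ∀ x ∈ odd, ∀ y ∈ odd, ∀ a ∈ even, (x * y) * a = a * (x * y)
  /-- Skew-symmetry of the odd product. -/
  odd_anticomm : ∀ x ∈ odd, ∀ y ∈ odd, x * y + y * x = 0
  /-- Skew-symmetry in the form that matters in characteristic `2`; it follows from `odd_anticomm` in
  every other characteristic. -/
  odd_sq : ∀ x ∈ odd, x * x = 0
  odd_jacobi : ∀ x ∈ odd, ∀ y ∈ odd, ∀ z ∈ odd, (x * y) * z + (y * z) * x + (z * x) * y = 0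

/-- The `Γ`-algebra `G = G₀ ⊕ G₁` is free on the space `V` of odd generators, embedded by `ι`: every
linear map of `V` into the odd part of a `Γ`-algebra `H` extends uniquely to a homomorphism of unital
algebras `G → H`, and this homomorphism respects the gradings. -/
def IsFreeGammaAlgebra {F : Type u} {V : Type v} {G : Type t} [Field F]
    [AddCommGroup V] [Module F V] [NonAssocRing G] [Module F G]
    [IsScalarTower F G G] [SMulCommClass F G G] (even odd : Submodule F G) (ι : V →ₗ[F] G) : Prop :=
  IsGammaAlgebra even odd ∧ (∀ v, ι v ∈ odd) ∧
    ∀ (H : Type w) [NonAssocRing H] [Module F H] [IsScalarTower F H H] [SMulCommClass F H H]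
      (even' odd' : Submodule F H), IsGammaAlgebra even' odd' →
      ∀ φ : V →ₗ[F] H, (∀ v, φ v ∈ odd') →
        ∃ f : G →ₙₐ[F] H, f 1 = 1 ∧ (∀ v, f (ι v) = φ v) ∧
          (∀ a ∈ even, f a ∈ even') ∧ (∀ x ∈ odd, f x ∈ odd') ∧
          ∀ f' : G →ₙₐ[F] H, f' 1 = 1 → (∀ v, f' (ι v) = φ v) → f' = f

/-! ### The algebra `R ⊕ M` of a bilinear map `β : M × M → R` -/

/-- For a module `M` over a commutative ring `R` and an `R`-bilinear map `β : M × M → R`, the space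
`R ⊕ M` with the product `(a + u)(b + v) = (ab + β(u, v)) + (av + bu)`. -/
def GammaExt {R M : Type*} [CommRing R] [AddCommGroup M] [Module R M]
    (_β : M →ₗ[R] M →ₗ[R] R) : Type _ := R × M

namespace GammaExt

section

variable {R M : Type*} [CommRing R] [AddCommGroup M] [Module R M] {β : M →ₗ[R] M →ₗ[R] R}

instance : AddCommGroup (GammaExt β) := inferInstanceAs (AddCommGroup (R × M))

instance : One (GammaExt β) := ⟨((1 : R), (0 : M))⟩

instance : Mul (GammaExt β) :=
  ⟨fun x y => (x.1 * y.1 + β x.2 y.2, x.1 • y.2 + y.1 • x.2)⟩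

theorem ext' {x y : GammaExt β} (h₁ : x.1 = y.1) (h₂ : x.2 = y.2) : x = y := Prod.ext h₁ h₂

instance : NonAssocRing (GammaExt β) :=
  { (inferInstance : AddCommGroup (GammaExt β)) with
    one := 1
    mul := (· * ·)
    zero_mul := fun x => ext'
      (show (0 : R) * x.1 + β 0 x.2 = 0 by simp) (show (0 : R) • x.2 + x.1 • (0 : M) = 0 by simp)
    mul_zero := fun x => ext'
      (show x.1 * (0 : R) + β x.2 0 = 0 by simp) (show x.1 • (0 : M) + (0 : R) • x.2 = 0 by simp)
    one_mul := fun x => ext'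
      (show (1 : R) * x.1 + β 0 x.2 = x.1 by simp)
      (show (1 : R) • x.2 + x.1 • (0 : M) = x.2 by simp)
    mul_one := fun x => ext'
      (show x.1 * (1 : R) + β x.2 0 = x.1 by simp)
      (show x.1 • (0 : M) + (1 : R) • x.2 = x.2 by simp)
    left_distrib := fun x y z => ext'
      (show x.1 * (y.1 + z.1) + β x.2 (y.2 + z.2)
          = (x.1 * y.1 + β x.2 y.2) + (x.1 * z.1 + β x.2 z.2) by
        rw [map_add]; ring)
      (show x.1 • (y.2 + z.2) + (y.1 + z.1) • x.2
          = (x.1 • y.2 + y.1 • x.2) + (x.1 • z.2 + z.1 • x.2) by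
        module)
    right_distrib := fun x y z => ext'
      (show (x.1 + y.1) * z.1 + β (x.2 + y.2) z.2
          = (x.1 * z.1 + β x.2 z.2) + (y.1 * z.1 + β y.2 z.2) by
        rw [map_add, LinearMap.add_apply]; ring)
      (show (x.1 + y.1) • z.2 + z.1 • (x.2 + y.2)
          = (x.1 • z.2 + z.1 • x.2) + (y.1 • z.2 + z.1 • y.2) by
        module) }

end

section

variable {F R M : Type*} [Field F] [CommRing R] [Algebra F R] [AddCommGroup M] [Module R M]
  [Module F M] [IsScalarTower F R M] {β : M →ₗ[R] M →ₗ[R] R}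

instance : Module F (GammaExt β) := inferInstanceAs (Module F (R × M))

instance : IsScalarTower F (GammaExt β) (GammaExt β) :=
  ⟨fun c x y => ext'
    (show (c • x.1) * y.1 + β (c • x.2) y.2 = c • (x.1 * y.1 + β x.2 y.2) by
      rw [← algebraMap_smul R c x.2, map_smul, LinearMap.smul_apply, smul_add, algebraMap_smul,
        smul_mul_assoc])
    (show (c • x.1) • y.2 + y.1 • (c • x.2) = c • (x.1 • y.2 + y.1 • x.2) by
      rw [smul_add, smul_assoc, ← algebraMap_smul R c x.2, smul_comm y.1, algebraMap_smul])⟩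

instance : SMulCommClass F (GammaExt β) (GammaExt β) :=
  ⟨fun c x y => ext'
    (show c • (x.1 * y.1 + β x.2 y.2) = x.1 * (c • y.1) + β x.2 (c • y.2) by
      rw [← algebraMap_smul R c y.2, map_smul, smul_add, algebraMap_smul, mul_smul_comm])
    (show c • (x.1 • y.2 + y.1 • x.2) = x.1 • (c • y.2) + (c • y.1) • x.2 by
      rw [smul_add, smul_assoc, ← algebraMap_smul R c y.2, smul_comm x.1, algebraMap_smul])⟩

variable (F β)

/-- The inclusion of the even part `R` into `R ⊕ M`. -/
def inEven : R →ₗ[F] GammaExt β := LinearMap.inl F R M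

/-- The inclusion of the odd part `M` into `R ⊕ M`. -/
def inOdd : M →ₗ[F] GammaExt β := LinearMap.inr F R M

/-- The even part of `R ⊕ M`. -/
def evenPart : Submodule F (GammaExt β) := LinearMap.range (inEven F β)

/-- The odd part of `R ⊕ M`. -/
def oddPart : Submodule F (GammaExt β) := LinearMap.range (inOdd F β)

end

end GammaExt

/-! ### The algebra `Γ(A)` -/

/-- The determinant form `((a, b), (c, d)) ↦ ad - bc` on `A²`. -/
def detForm (A : Type*) [CommRing A] : (A × A) →ₗ[A] (A × A) →ₗ[A] A :=
  LinearMap.mk₂ A (fun p q => p.1 * q.2 - p.2 * q.1)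
    (fun p p' q => by simp only [Prod.fst_add, Prod.snd_add]; ring)
    (fun c p q => by simp only [Prod.smul_fst, Prod.smul_snd, smul_eq_mul]; ring)
    (fun p q q' => by simp only [Prod.fst_add, Prod.snd_add]; ring)
    (fun c p q => by simp only [Prod.smul_fst, Prod.smul_snd, smul_eq_mul]; ring)

/-- `Γ(A) = A ⊕ A²`, with `a · (b, c) = (b, c) · a = (ab, ac)` and `(a, b) · (c, d) = ad - bc`. -/
abbrev GammaOf (A : Type*) [CommRing A] : Type _ := GammaExt (detForm A)

/-! ### The algebra `Γ[∅; V]` -/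

section Free

theorem update_pair_zero {X : Type*} (u v x : X) : Function.update ![u, v] 0 x = ![x, v] := by
  funext i; fin_cases i <;> simp

theorem update_pair_one {X : Type*} (u v x : X) : Function.update ![u, v] 1 x = ![u, x] := by
  funext i; fin_cases i <;> simp

variable (F V : Type*) [Field F] [AddCommGroup V] [Module F V]

/-- The bivector `u ∧ v` as an element of the polynomial algebra `F[⋀² V]`. -/
def bivector (u v : V) : SymmetricAlgebra F (⋀[F]^2 V) :=
  SymmetricAlgebra.ι F (⋀[F]^2 V) (exteriorPower.ιMulti F 2 ![u, v])

/-- The ideal of `F[⋀² V]` generated by the double Plücker relations. -/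
def doublePlucker : Ideal (SymmetricAlgebra F (⋀[F]^2 V)) :=
  Ideal.span {p | ∃ u v w z : V, p =
    bivector F V u v * bivector F V w z + bivector F V u w * bivector F V z v
      + bivector F V u z * bivector F V v w}

/-- The coordinate algebra `F[Gr(2, V)] = F[⋀² V] / P`. -/
def GrCoord : Type _ := SymmetricAlgebra F (⋀[F]^2 V) ⧸ doublePlucker F V

instance : CommRing (GrCoord F V) :=
  inferInstanceAs (CommRing (SymmetricAlgebra F (⋀[F]^2 V) ⧸ doublePlucker F V))

instance : Algebra F (GrCoord F V) :=
  inferInstanceAs (Algebra F (SymmetricAlgebra F (⋀[F]^2 V) ⧸ doublePlucker F V))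

/-- The projection `F[⋀² V] → F[Gr(2, V)]`. -/
def grMk : SymmetricAlgebra F (⋀[F]^2 V) →ₐ[F] GrCoord F V :=
  Ideal.Quotient.mkₐ F (doublePlucker F V)

/-- The bilinear map `(u, v) ↦ u ∧ v` with values in `F[Gr(2, V)]`. -/
def grWedge : V →ₗ[F] V →ₗ[F] GrCoord F V :=
  LinearMap.mk₂ F (fun u v => grMk F V (bivector F V u v))
    (fun u u' v => by
      have h := (exteriorPower.ιMulti F 2 (M := V)).map_update_add ![u, v] 0 u u'
      simp only [update_pair_zero] at h
      simp only [bivector, h, map_add])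
    (fun c u v => by
      have h := (exteriorPower.ιMulti F 2 (M := V)).map_update_smul ![u, v] 0 c u
      simp only [update_pair_zero] at h
      simp only [bivector, h, map_smul])
    (fun u v v' => by
      have h := (exteriorPower.ιMulti F 2 (M := V)).map_update_add ![u, v] 1 v v'
      simp only [update_pair_one] at h
      simp only [bivector, h, map_add])
    (fun c u v => by
      have h := (exteriorPower.ιMulti F 2 (M := V)).map_update_smul ![u, v] 1 c v
      simp only [update_pair_one] at h
      simp only [bivector, h, map_smul])

theorem grWedge_swap (u v : V) : grWedge F V u v = - grWedge F V v u := by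
  have h := (exteriorPower.ιMulti F 2 (M := V)).map_swap ![v, u] (i := 0) (j := 1) (by decide)
  have e : (![v, u] ∘ (Equiv.swap (0 : Fin 2) 1)) = ![u, v] := by
    funext i; fin_cases i <;> simp
  rw [e] at h
  simp only [grWedge, LinearMap.mk₂_apply, bivector, h, map_neg]

theorem grWedge_plucker (u v w z : V) :
    grWedge F V u v * grWedge F V w z + grWedge F V u w * grWedge F V z v
      + grWedge F V u z * grWedge F V v w = 0 := by
  exact Ideal.Quotient.eq_zero_iff_mem.mpr (Ideal.subset_span ⟨u, v, w, z, rfl⟩)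

variable {F V}

section

open TensorProduct

variable {R : Type*} [CommRing R] [Algebra F R]

/-- For a bilinear map `ω : V × V → R`, the submodule of `R ⊗ V` generated by the ordinary Plücker
relations `ω(u, v) ⊗ w + ω(v, w) ⊗ u + ω(w, u) ⊗ v`. -/
def ordinaryPlucker (ω : V →ₗ[F] V →ₗ[F] R) : Submodule R (R ⊗[F] V) :=
  Submodule.span R {p | ∃ u v w : V, p = ω u v ⊗ₜ[F] w + ω v w ⊗ₜ[F] u + ω w u ⊗ₜ[F] v}

/-- The `R`-bilinear form `(a ⊗ u, b ⊗ v) ↦ ab ω(u, v)` on `R ⊗ V`. -/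
def tensorForm (ω : V →ₗ[F] V →ₗ[F] R) : (R ⊗[F] V) →ₗ[R] (R ⊗[F] V) →ₗ[R] R :=
  LinearMap.liftBaseChange R
    (((LinearMap.liftBaseChangeEquiv R).toLinearMap.restrictScalars F) ∘ₗ ω)

theorem tensorForm_tmul (ω : V →ₗ[F] V →ₗ[F] R) (a b : R) (u v : V) :
    tensorForm ω (a ⊗ₜ u) (b ⊗ₜ v) = a * b * ω u v := by
  simp [tensorForm, mul_assoc]

theorem ordinaryPlucker_le_ker (ω : V →ₗ[F] V →ₗ[F] R) (h₁ : ∀ u v, ω u v = - ω v u)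
    (h₂ : ∀ u v w z, ω u v * ω w z + ω u w * ω z v + ω u z * ω v w = 0) :
    ordinaryPlucker ω ≤ LinearMap.ker (tensorForm ω) := by
  rw [ordinaryPlucker, Submodule.span_le]
  rintro _ ⟨u, v, w, rfl⟩
  rw [SetLike.mem_coe, LinearMap.mem_ker]
  refine TensorProduct.AlgebraTensorModule.curry_injective (LinearMap.ext_ring
    (LinearMap.ext fun z => ?_))
  have h := h₂ u v w z
  rw [h₁ z v, h₁ u w, h₁ u z] at h
  simp only [map_add, LinearMap.add_apply, TensorProduct.AlgebraTensorModule.curry_apply,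
    TensorProduct.curry_apply, LinearMap.restrictScalars_apply, tensorForm_tmul]
  simp
  rw [h₁ u z] 
  linear_combination h

theorem ordinaryPlucker_le_ker_flip (ω : V →ₗ[F] V →ₗ[F] R) (h₁ : ∀ u v, ω u v = - ω v u)
    (h₂ : ∀ u v w z, ω u v * ω w z + ω u w * ω z v + ω u z * ω v w = 0) :
    ordinaryPlucker ω ≤ LinearMap.ker
      ((ordinaryPlucker ω).liftQ (tensorForm ω) (ordinaryPlucker_le_ker ω h₁ h₂)).flip := by
  have symm : ∀ x y, tensorForm ω x y = - tensorForm ω y x := fun x y => by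
    induction x with
    | zero => simp
    | add x x' hx hx' => simp only [map_add, LinearMap.add_apply, hx, hx']; ring
    | tmul a u =>
      induction y with
      | zero => simp
      | add y y' hy hy' => simp only [map_add, LinearMap.add_apply, hy, hy']; ring
      | tmul b v => rw [tensorForm_tmul, tensorForm_tmul, h₁ u v]; ring
  intro x hx
  rw [LinearMap.mem_ker]
  refine LinearMap.ext fun q => ?_
  obtain ⟨y, rfl⟩ := Submodule.mkQ_surjective _ q
  have hx' := LinearMap.mem_ker.mp (ordinaryPlucker_le_ker ω h₁ h₂ hx)
  simp only [LinearMap.flip_apply, Submodule.mkQ_apply, Submodule.liftQ_apply]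
  rw [symm, hx']
  simp

/-- The form `(a ⊗ u, b ⊗ v) ↦ ab ω(u, v)` on the quotient of `R ⊗ V` by the ordinary Plücker
relations; it is well defined if `ω` is skew-symmetric and satisfies the double Plücker relations. -/
def quotientForm (ω : V →ₗ[F] V →ₗ[F] R) (h₁ : ∀ u v, ω u v = - ω v u)
    (h₂ : ∀ u v w z, ω u v * ω w z + ω u w * ω z v + ω u z * ω v w = 0) :
    ((R ⊗[F] V) ⧸ ordinaryPlucker ω) →ₗ[R] ((R ⊗[F] V) ⧸ ordinaryPlucker ω) →ₗ[R] R :=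
  ((ordinaryPlucker ω).liftQ
    ((ordinaryPlucker ω).liftQ (tensorForm ω) (ordinaryPlucker_le_ker ω h₁ h₂)).flip
    (ordinaryPlucker_le_ker_flip ω h₁ h₂)).flip

theorem quotientForm_mk (ω : V →ₗ[F] V →ₗ[F] R) (h₁ : ∀ u v, ω u v = - ω v u)
    (h₂ : ∀ u v w z, ω u v * ω w z + ω u w * ω z v + ω u z * ω v w = 0) (a b : R) (u v : V) :
    quotientForm ω h₁ h₂ ((ordinaryPlucker ω).mkQ (a ⊗ₜ u)) ((ordinaryPlucker ω).mkQ (b ⊗ₜ v))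
      = a * b * ω u v := by
  simp only [quotientForm, LinearMap.flip_apply, Submodule.mkQ_apply, Submodule.liftQ_apply,
    tensorForm_tmul]

end

variable (F V)

open TensorProduct in
/-- The `F[Gr(2, V)]`-module `F[Gr(2, V)]₁`, the quotient of `F[Gr(2, V)] ⊗ V` by the ordinary
Plücker relations `(u ∧ v) ⊗ w + (v ∧ w) ⊗ u + (w ∧ u) ⊗ v`. -/
abbrev GrOdd : Type _ := (GrCoord F V ⊗[F] V) ⧸ ordinaryPlucker (grWedge F V)

/-- The product `F[Gr(2, V)]₁ × F[Gr(2, V)]₁ → F[Gr(2, V)]`, `(a ⊗ u)(b ⊗ v) = ab (u ∧ v)`. -/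
def grOddForm : GrOdd F V →ₗ[GrCoord F V] GrOdd F V →ₗ[GrCoord F V] GrCoord F V :=
  quotientForm (grWedge F V) (grWedge_swap F V) (grWedge_plucker F V)

/-- `Γ[∅; V] = F[Gr(2, V)] ⊕ F[Gr(2, V)]₁`. -/
abbrev FreeGamma : Type _ := GammaExt (grOddForm F V)

/-- The inclusion `v ↦ 1 ⊗ v` of the space of odd generators `V` into `Γ[∅; V]`. -/
def freeGammaι : V →ₗ[F] FreeGamma F V :=
  GammaExt.inOdd F (grOddForm F V) ∘ₗ
    ((ordinaryPlucker (grWedge F V)).mkQ.restrictScalars F) ∘ₗ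
      TensorProduct.mk F (GrCoord F V) V 1

end Free

/-! ### The subalgebra of `Γ(A_n)` and the standard monomials -/

section Standard

variable (F : Type*) [Field F] (n : ℕ)

/-- `A_n = F[x_1, …, x_n; y_1, …, y_n]`; `x_i` is the variable `Sum.inl i`, and `y_i` is `Sum.inr i`. -/
abbrev PolyA : Type _ := MvPolynomial (Fin n ⊕ Fin n) F

variable {n}

/-- The element `(x_i, y_i)` of `A_n²`. -/
def xy (i : Fin n) : PolyA F n × PolyA F n :=
  (MvPolynomial.X (Sum.inl i), MvPolynomial.X (Sum.inr i))

/-- The odd element `v_i = (x_i, y_i)` of `Γ(A_n)`. -/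
def vGen (i : Fin n) : GammaOf (PolyA F n) := GammaExt.inOdd F (detForm (PolyA F n)) (xy F i)

/-- The Plücker coordinate `α_{ij} = x_i y_j - x_j y_i`. -/
def alpha (i j : Fin n) : PolyA F n :=
  MvPolynomial.X (Sum.inl i) * MvPolynomial.X (Sum.inr j)
    - MvPolynomial.X (Sum.inl j) * MvPolynomial.X (Sum.inr i)

variable (n)

/-- `S_n`, the subalgebra of `A_n` generated by the `α_{ij}`, `i < j`. -/
def pluckerAlg : Subalgebra F (PolyA F n) :=
  Algebra.adjoin F {a | ∃ i j : Fin n, i < j ∧ a = alpha F i j}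

/-- `S_n` as a subspace of (the even part of) `Γ(A_n)`. -/
def spaceS : Submodule F (GammaOf (PolyA F n)) :=
  (Subalgebra.toSubmodule (pluckerAlg F n)).map (GammaExt.inEven F (detForm (PolyA F n)))

/-- `V`, the span of `v_1, …, v_n` in `Γ(A_n)`. -/
def spaceV : Submodule F (GammaOf (PolyA F n)) := Submodule.span F (Set.range (vGen F))

/-- `S_n V`, the span in `Γ(A_n)` of the products `s v` with `s ∈ S_n` and `v ∈ V`. -/
def spaceSV : Submodule F (GammaOf (PolyA F n)) :=
  Submodule.span F {g | ∃ s ∈ spaceS F n, ∃ v ∈ spaceV F n, g = s * v}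

/-- The unital subalgebra of `Γ(A_n)` generated by `v_1, …, v_n`. -/
def genSubalgebra : NonUnitalSubalgebra F (GammaOf (PolyA F n)) :=
  NonUnitalAlgebra.adjoin F ({1} ∪ Set.range (vGen F))

/-- Index sequences `(i_1, j_1), …, (i_r, j_r)`, `r ≥ 0`, with `i_s < j_s`,
`i_1 ≤ i_2 ≤ ⋯ ≤ i_r` and `j_1 ≤ j_2 ≤ ⋯ ≤ j_r`. -/
def StdIndex : Type :=
  {l : List (Fin n × Fin n) //
    (∀ p ∈ l, p.1 < p.2) ∧ l.Pairwise (fun p q => p.1 ≤ q.1 ∧ p.2 ≤ q.2)}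

variable {n}

/-- The standard monomial `α_{i_1 j_1} ⋯ α_{i_r j_r}`; these are the elements of `B_n`. -/
def stdMonomial (l : StdIndex n) : PolyA F n :=
  (l.1.map (fun p => alpha F p.1 p.2)).prod

/-- The index sequences of `B_{n,m}`: those with `j_1 ≥ m`, equivalently with all `j_s ≥ m`. -/
def StdIndexGE (m : Fin n) : Type := {l : StdIndex n // ∀ p ∈ l.1, m ≤ p.2}

end Standard

end

/-! Freeness (`isFreeGammaAlgebra_freeGamma`). The double Plücker relations hold for odd elements of
any `Γ`-algebra `H`: multiply the Jacobi identity by a fourth odd element (`odd_plucker`). The even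
part of `H` may be noncommutative, so `F[Gr(2, V)]` is mapped not to `H` but to the commutative
algebra `centralMul` of left multiplications by central even elements. The ordinary Plücker
relations are killed by the Jacobi identity itself, which extends the map to the odd part.
Uniqueness holds because `1` and `V` generate `Γ[∅; V]`.

For the isomorphism and the basis, let `f` be the homomorphism `Γ[∅; Fⁿ] → Γ(A_n)` with `e_i ↦ v_i`.
Two facts suffice. The standard elements span `Γ[∅; Fⁿ]` (`span_freeStd`), since the Plücker
relations rewrite a nonstandard product into products with a smaller sum of squared lengths. Their
images under `f` are linearly independent (`linearIndependent_stdElement`), since for the weight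
`y_j ↦ j` they have distinct leading monomials with coefficient `1`, in any characteristic. So `f`
is injective and carries a basis to the standard elements of `Γ(A_n)`. These lie in `S_n + S_n V`,
which lies in the generated subalgebra, which in turn lies in the range of `f`; hence all these
spaces coincide. -/

noncomputable section

/-! ### The algebra of an alternating form, and `Γ(A)`. -/

namespace GammaExt

section

variable {F R M : Type*} [Field F] [CommRing R] [Algebra F R] [AddCommGroup M] [Module R M]
  [Module F M] {β : M →ₗ[R] M →ₗ[R] R}

theorem fst_mul (x y : GammaExt β) : (x * y).1 = x.1 * y.1 + β x.2 y.2 := rfl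

theorem snd_mul (x y : GammaExt β) : (x * y).2 = x.1 • y.2 + y.1 • x.2 := rfl

theorem fst_add (x y : GammaExt β) : (x + y).1 = x.1 + y.1 := rfl

theorem snd_add (x y : GammaExt β) : (x + y).2 = x.2 + y.2 := rfl

theorem fst_zero : (0 : GammaExt β).1 = 0 := rfl

theorem snd_zero : (0 : GammaExt β).2 = 0 := rfl

theorem fst_inEven (a : R) : (inEven F β a).1 = a := rfl

theorem snd_inEven (a : R) : (inEven F β a).2 = 0 := rfl

theorem fst_inOdd (m : M) : (inOdd F β m).1 = 0 := rfl

theorem snd_inOdd (m : M) : (inOdd F β m).2 = m := rfl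

theorem inEven_one : inEven F β 1 = 1 := rfl

theorem inEven_mul (a b : R) : inEven F β (a * b) = inEven F β a * inEven F β b :=
  ext' (by simp [fst_mul, fst_inEven, snd_inEven]) (by simp [snd_mul, snd_inEven])

theorem inEven_mul_inOdd (a : R) (m : M) : inEven F β a * inOdd F β m = inOdd F β (a • m) :=
  ext' (by simp [fst_mul, fst_inOdd, snd_inEven])
    (by simp [snd_mul, snd_inEven, fst_inEven, snd_inOdd])

theorem inOdd_mul_inOdd (m m' : M) : inOdd F β m * inOdd F β m' = inEven F β (β m m') :=
  ext' (by simp [fst_mul, fst_inOdd, snd_inOdd, fst_inEven])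
    (by simp [snd_mul, snd_inEven, fst_inOdd])

theorem eq_inEven_add_inOdd (x : GammaExt β) : x = inEven F β x.1 + inOdd F β x.2 :=
  ext' (by simp [fst_add, fst_inOdd, fst_inEven]) (by simp [snd_add, snd_inEven, snd_inOdd])

variable (F) in
theorem mem_evenPart {x : GammaExt β} : x ∈ evenPart F β ↔ x.2 = 0 :=
  ⟨by rintro ⟨a, rfl⟩; rfl, fun h => ⟨x.1, ext' rfl h.symm⟩⟩

variable (F) in
theorem mem_oddPart {x : GammaExt β} : x ∈ oddPart F β ↔ x.1 = 0 :=
  ⟨by rintro ⟨a, rfl⟩; rfl, fun h => ⟨x.2, ext' h.symm rfl⟩⟩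

/-- If `β` is alternating and satisfies the Jacobi-type identity, then `R ⊕ M` is a `Γ`-algebra. -/
theorem isGammaAlgebra [IsScalarTower F R M] (h₁ : ∀ x, β x x = 0)
    (h₂ : ∀ x y z, β x y • z + β y z • x + β z x • y = 0) :
    IsGammaAlgebra (evenPart F β) (oddPart F β) where
  isCompl := by
    refine IsCompl.of_eq (eq_bot_iff.2 fun x hx => ?_) (eq_top_iff.2 fun x _ => ?_)
    · exact ext' ((mem_oddPart F).1 hx.2) ((mem_evenPart F).1 hx.1)
    · rw [eq_inEven_add_inOdd (F := F) x]
      exact Submodule.add_mem_sup ⟨_, rfl⟩ ⟨_, rfl⟩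
  one_mem := ⟨1, rfl⟩
  even_mul_even a ha b hb := by
    rw [mem_evenPart] at *; simp [snd_mul, ha, hb]
  even_mul_odd a ha b hb := by
    rw [mem_evenPart] at ha; rw [mem_oddPart] at *; simp [fst_mul, ha, hb]
  odd_mul_even a ha b hb := by
    rw [mem_evenPart] at hb; rw [mem_oddPart] at *; simp [fst_mul, ha, hb]
  odd_mul_odd a ha b hb := by
    rw [mem_evenPart]; rw [mem_oddPart] at *; simp [snd_mul, ha, hb]
  even_assoc a ha g h := by
    rw [mem_evenPart] at ha
    refine ext' ?_ ?_
    · simp [fst_mul, snd_mul, ha]; ring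
    · simp [fst_mul, snd_mul, ha, mul_smul, smul_comm h.1 a.1]
  even_comm_odd a ha x hx := by
    rw [mem_evenPart] at ha; rw [mem_oddPart] at hx
    exact ext' (by simp [fst_mul, ha, hx]) (by simp [snd_mul, ha, hx])
  odd_mul_odd_comm x hx y hy a ha := by
    rw [mem_evenPart] at ha; rw [mem_oddPart] at hx hy
    exact ext' (by simp [fst_mul, snd_mul, ha, hx, hy, mul_comm])
      (by simp [fst_mul, snd_mul, ha, hx, hy])
  odd_anticomm x hx y hy := by
    rw [mem_oddPart] at hx hy
    have h : β x.2 y.2 + β y.2 x.2 = 0 := by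
      have := h₁ (x.2 + y.2)
      simpa [h₁] using this
    exact ext' (by simpa [fst_add, fst_mul, hx, hy, fst_zero] using h)
      (by simp [snd_add, snd_mul, hx, hy, snd_zero])
  odd_sq x hx := by
    rw [mem_oddPart] at hx
    exact ext' (by simp [fst_mul, hx, h₁, fst_zero]) (by simp [snd_mul, hx, snd_zero])
  odd_jacobi x hx y hy z hz := by
    rw [mem_oddPart] at hx hy hz
    exact ext' (by simp [fst_add, fst_mul, snd_mul, hx, hy, hz, fst_zero])
      (by simpa [snd_add, fst_mul, snd_mul, hx, hy, hz, snd_zero] using h₂ x.2 y.2 z.2)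

end

end GammaExt

theorem detForm_apply {A : Type*} [CommRing A] (p q : A × A) :
    detForm A p q = p.1 * q.2 - p.2 * q.1 := rfl

/-- The Jacobi identity for three vectors of `A²` is Cramer's rule: a `3 × 3` determinant with a
repeated row vanishes. -/
theorem isGammaAlgebra_gammaOf (F A : Type*) [Field F] [CommRing A] [Algebra F A] :
    IsGammaAlgebra (GammaExt.evenPart F (detForm A)) (GammaExt.oddPart F (detForm A)) := by
  refine GammaExt.isGammaAlgebra (fun x => ?_) fun x y z => ?_
  · rw [detForm_apply]; ring
  · refine Prod.ext ?_ ?_ <;> simp [detForm_apply] <;> ring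

/-! ### `Γ[∅; V]` is a `Γ`-algebra generated by `V`. -/

section Free

open TensorProduct

variable (F V : Type*) [Field F] [AddCommGroup V] [Module F V]

/-- In characteristic `2` this does not follow from `grWedge_swap`. -/
theorem grWedge_self (u : V) : grWedge F V u u = 0 := by
  have h := (exteriorPower.ιMulti F 2 (M := V)).map_eq_zero_of_eq ![u, u] (i := 0) (j := 1)
    (by simp) (by decide)
  simp [grWedge, bivector, h]

/-- The class of `a ⊗ u` in `F[Gr(2, V)]₁`. -/
def grOddMk (a : GrCoord F V) (u : V) : GrOdd F V :=
  (ordinaryPlucker (grWedge F V)).mkQ (a ⊗ₜ u)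

variable {F V}

theorem smul_grOddMk (a b : GrCoord F V) (u : V) :
    a • grOddMk F V b u = grOddMk F V (a * b) u := by
  rw [grOddMk, ← map_smul, TensorProduct.smul_tmul', smul_eq_mul, grOddMk]

theorem grOddMk_add_left (a b : GrCoord F V) (u : V) :
    grOddMk F V (a + b) u = grOddMk F V a u + grOddMk F V b u := by
  rw [grOddMk, TensorProduct.add_tmul, map_add, grOddMk, grOddMk]

theorem grOddMk_add_right (a : GrCoord F V) (u v : V) :
    grOddMk F V a (u + v) = grOddMk F V a u + grOddMk F V a v := by
  rw [grOddMk, TensorProduct.tmul_add, map_add, grOddMk, grOddMk]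

theorem grOddMk_smul_right (c : F) (a : GrCoord F V) (u : V) :
    grOddMk F V a (c • u) = c • grOddMk F V a u := by
  rw [grOddMk, TensorProduct.tmul_smul]; rfl

@[elab_as_elim]
theorem grOdd_induction {p : GrOdd F V → Prop} (zero : p 0) (mk : ∀ a u, p (grOddMk F V a u))
    (add : ∀ x y, p x → p y → p (x + y)) (x : GrOdd F V) : p x := by
  obtain ⟨x, rfl⟩ := Submodule.mkQ_surjective _ x
  induction x with
  | zero => simpa using zero
  | tmul a u => exact mk a u
  | add x y hx hy => rw [map_add]; exact add _ _ hx hy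

theorem grOddForm_mk (a b : GrCoord F V) (u v : V) :
    grOddForm F V (grOddMk F V a u) (grOddMk F V b v) = a * b * grWedge F V u v :=
  quotientForm_mk _ _ _ a b u v

theorem grOdd_plucker (u v w : V) :
    grOddMk F V (grWedge F V u v) w + grOddMk F V (grWedge F V v w) u
      + grOddMk F V (grWedge F V w u) v = 0 := by
  rw [grOddMk, grOddMk, grOddMk, ← map_add, ← map_add]
  exact (Submodule.Quotient.mk_eq_zero _).2 (Submodule.subset_span ⟨u, v, w, rfl⟩)

theorem grOddForm_swap (x y : GrOdd F V) : grOddForm F V x y = - grOddForm F V y x := by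
  induction x using grOdd_induction with
  | zero => simp
  | add x x' hx hx' => rw [map_add, LinearMap.add_apply, hx, hx', map_add]; ring
  | mk a u =>
    induction y using grOdd_induction with
    | zero => simp
    | add x x' hx hx' => rw [map_add, map_add, LinearMap.add_apply, hx, hx']; ring
    | mk b v => rw [grOddForm_mk, grOddForm_mk, grWedge_swap F V u v]; ring

theorem grOddForm_self (x : GrOdd F V) : grOddForm F V x x = 0 := by
  induction x using grOdd_induction with
  | zero => simp
  | mk a u => rw [grOddForm_mk, grWedge_self, mul_zero]
  | add x y hx hy =>
    rw [map_add, map_add, LinearMap.add_apply, LinearMap.add_apply, hx, hy, grOddForm_swap x y]; ring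

/-- The left side is additive in each argument, and on `a ⊗ u`, `b ⊗ v`, `c ⊗ w` it is `abc` times
an ordinary Plücker relation. -/
theorem grOddForm_jacobi (x y z : GrOdd F V) :
    grOddForm F V x y • z + grOddForm F V y z • x + grOddForm F V z x • y = 0 := by
  induction x using grOdd_induction with
  | zero => simp
  | add x x' hx hx' =>
    simp only [map_add, LinearMap.add_apply, add_smul, smul_add]
    -- The right side becomes `0 + 0`, and each zero is replaced by the left side of an induction
    -- hypothesis.
    rw [← add_zero (0 : GrOdd F V)]
    nth_rewrite 1 [← hx]
    rw [← hx']
    abel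
  | mk a u =>
    induction y using grOdd_induction with
    | zero => simp
    | add x x' hx hx' =>
      simp only [map_add, LinearMap.add_apply, add_smul, smul_add]
      rw [← add_zero (0 : GrOdd F V)]
      nth_rewrite 1 [← hx]
      rw [← hx']
      abel
    | mk b v =>
      induction z using grOdd_induction with
      | zero => simp
      | add x x' hx hx' =>
        simp only [map_add, LinearMap.add_apply, add_smul, smul_add]
        rw [← add_zero (0 : GrOdd F V)]
        nth_rewrite 1 [← hx]
        rw [← hx']
        abel
      | mk c w =>
        have h := congrArg (fun t : GrOdd F V => (a * b * c) • t) (grOdd_plucker u v w)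
        simp only [grOddForm_mk, smul_grOddMk, smul_add, smul_zero] at h ⊢
        rw [← h, show a * b * grWedge F V u v * c = a * b * c * grWedge F V u v by ring,
          show b * c * grWedge F V v w * a = a * b * c * grWedge F V v w by ring,
          show c * a * grWedge F V w u * b = a * b * c * grWedge F V w u by ring]

variable (F V)

theorem isGammaAlgebra_freeGamma :
    IsGammaAlgebra (GammaExt.evenPart F (grOddForm F V)) (GammaExt.oddPart F (grOddForm F V)) :=
  GammaExt.isGammaAlgebra grOddForm_self grOddForm_jacobi

theorem freeGammaι_apply (v : V) :
    freeGammaι F V v = GammaExt.inOdd F (grOddForm F V) (grOddMk F V 1 v) := rfl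

theorem inEven_mul_freeGammaι (a : GrCoord F V) (v : V) :
    GammaExt.inEven F (grOddForm F V) a * freeGammaι F V v =
      GammaExt.inOdd F (grOddForm F V) (grOddMk F V a v) := by
  rw [freeGammaι_apply, GammaExt.inEven_mul_inOdd, smul_grOddMk, mul_one]

theorem freeGammaι_mul (u v : V) : freeGammaι F V u * freeGammaι F V v =
    GammaExt.inEven F (grOddForm F V) (grWedge F V u v) := by
  rw [freeGammaι_apply, freeGammaι_apply, GammaExt.inOdd_mul_inOdd, grOddForm_mk, one_mul, one_mul]

/-- A symmetric algebra is generated by its underlying space, and `⋀² V` is spanned by the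
decomposable bivectors. -/
theorem adjoin_grWedge :
    Algebra.adjoin F {a | ∃ u v : V, a = grWedge F V u v} = ⊤ := by
  rw [eq_top_iff]
  rintro x -
  obtain ⟨x, rfl⟩ := Ideal.Quotient.mkₐ_surjective F (doublePlucker F V) x
  change grMk F V x ∈ _
  induction x using SymmetricAlgebra.induction with
  | algebraMap r => rw [AlgHom.commutes]; exact Subalgebra.algebraMap_mem _ r
  | ι x =>
    have hx : x ∈ Submodule.span F (Set.range (exteriorPower.ιMulti F 2 (M := V))) := by
      rw [exteriorPower.ιMulti_span]; trivial
    induction hx using Submodule.span_induction with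
    | mem x h =>
      obtain ⟨m, rfl⟩ := h
      refine Algebra.subset_adjoin ⟨m 0, m 1, ?_⟩
      have : m = ![m 0, m 1] := by funext i; fin_cases i <;> rfl
      conv_lhs => rw [this]
      rfl
    | zero => simp
    | add x y _ _ hx hy => rw [map_add, map_add]; exact add_mem hx hy
    | smul c x _ hx => rw [map_smul, map_smul]; exact Subalgebra.smul_mem _ hx c
  | mul a b ha hb => rw [map_mul]; exact mul_mem ha hb
  | add a b ha hb => rw [map_add]; exact add_mem ha hb

/-- The products `uv = u ∧ v` give the whole even part, and then `a · u = a ⊗ u` gives the odd part.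
This is the uniqueness half of freeness. -/
theorem adjoin_freeGammaι :
    NonUnitalAlgebra.adjoin F ({1} ∪ Set.range (freeGammaι F V)) = ⊤ := by
  rw [eq_top_iff]
  rintro x -
  set K := NonUnitalAlgebra.adjoin F ({1} ∪ Set.range (freeGammaι F V))
  have hι : ∀ v, freeGammaι F V v ∈ K := fun v =>
    NonUnitalAlgebra.subset_adjoin F (Or.inr ⟨v, rfl⟩)
  have h1 : (1 : FreeGamma F V) ∈ K := NonUnitalAlgebra.subset_adjoin F (Or.inl rfl)
  have he : ∀ a, GammaExt.inEven F (grOddForm F V) a ∈ K := fun a => by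
    have ha : a ∈ Algebra.adjoin F {a | ∃ u v : V, a = grWedge F V u v} := by
      rw [adjoin_grWedge]; trivial
    induction ha using Algebra.adjoin_induction with
    | mem x h => obtain ⟨u, v, rfl⟩ := h; rw [← freeGammaι_mul]; exact mul_mem (hι u) (hι v)
    | algebraMap r =>
      rw [Algebra.algebraMap_eq_smul_one, map_smul, GammaExt.inEven_one]
      exact K.smul_mem' r h1
    | add x y _ _ hx hy => rw [map_add]; exact add_mem hx hy
    | mul x y _ _ hx hy => rw [GammaExt.inEven_mul]; exact mul_mem hx hy
  have ho : ∀ m, GammaExt.inOdd F (grOddForm F V) m ∈ K := fun m => by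
    induction m using grOdd_induction with
    | zero => simp
    | mk a u => rw [← inEven_mul_freeGammaι]; exact mul_mem (he a) (hι u)
    | add x y hx hy => rw [map_add]; exact add_mem hx hy
  rw [GammaExt.eq_inEven_add_inOdd (F := F) x]
  exact add_mem (he _) (ho _)

end Free


/-! ### The universal property of `Γ[∅; V]`. -/

section Lift

open TensorProduct

variable {F V : Type*} [Field F] [AddCommGroup V] [Module F V]

/-- A bilinear map `ω` with `ω(u, u) = 0` as an alternating map in two variables. -/
def alternatingOfBilin {N : Type*} [AddCommGroup N] [Module F N] (ω : V →ₗ[F] V →ₗ[F] N)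
    (h : ∀ u, ω u u = 0) : V [⋀^Fin 2]→ₗ[F] N where
  toFun m := ω (m 0) (m 1)
  map_update_add' := by
    intro inst m i x y
    -- The field quantifies over all decidability instances; with the standard one `simp` can
    -- evaluate `Function.update`.
    obtain rfl : inst = instDecidableEqFin 2 := Subsingleton.elim _ _
    fin_cases i <;> simp
  map_update_smul' := by
    intro inst m i c x
    obtain rfl : inst = instDecidableEqFin 2 := Subsingleton.elim _ _
    fin_cases i <;> simp
  map_eq_zero_of_eq' m i j hij hne := by
    have : m 0 = m 1 := by
      fin_cases i <;> fin_cases j <;> simp_all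
    rw [this, h]

/-- The algebra homomorphism `F[Gr(2, V)] → R` defined by an alternating bilinear map with values
in `R` that satisfies the double Plücker relations. -/
def grLift {R : Type*} [CommRing R] [Algebra F R] (ω : V →ₗ[F] V →ₗ[F] R) (h₁ : ∀ u, ω u u = 0)
    (h₂ : ∀ u v w z, ω u v * ω w z + ω u w * ω z v + ω u z * ω v w = 0) :
    GrCoord F V →ₐ[F] R :=
  Ideal.Quotient.liftₐ (doublePlucker F V)
    (SymmetricAlgebra.lift (exteriorPower.alternatingMapLinearEquiv (alternatingOfBilin ω h₁)))
    (fun a ha => by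
      have key : doublePlucker F V ≤ RingHom.ker (SymmetricAlgebra.lift
          (exteriorPower.alternatingMapLinearEquiv (alternatingOfBilin ω h₁))) := by
        refine Ideal.span_le.2 ?_
        rintro _ ⟨u, v, w, z, rfl⟩
        rw [SetLike.mem_coe, RingHom.mem_ker]
        simp only [map_add, map_mul, bivector, SymmetricAlgebra.lift_ι_apply,
          exteriorPower.alternatingMapLinearEquiv_apply_ιMulti]
        exact h₂ u v w z
      exact key ha)

theorem grLift_grWedge {R : Type*} [CommRing R] [Algebra F R] (ω : V →ₗ[F] V →ₗ[F] R)
    (h₁ : ∀ u, ω u u = 0)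
    (h₂ : ∀ u v w z, ω u v * ω w z + ω u w * ω z v + ω u z * ω v w = 0) (u v : V) :
    grLift ω h₁ h₂ (grWedge F V u v) = ω u v := by
  change SymmetricAlgebra.lift _ (bivector F V u v) = _
  rw [bivector, SymmetricAlgebra.lift_ι_apply,
    exteriorPower.alternatingMapLinearEquiv_apply_ιMulti]
  rfl

variable {H : Type*} [NonAssocRing H] [Module F H] [IsScalarTower F H H] [SMulCommClass F H H]
  {even odd : Submodule F H}

namespace IsGammaAlgebra

/-- The left multiplications of a `Γ`-algebra by the elements of the centre of its even part. -/
def centralMul (h : IsGammaAlgebra even odd) : Subalgebra F (Module.End F H) where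
  carrier := {T | T 1 ∈ even ∧ (∀ b ∈ even, T 1 * b = b * T 1) ∧ ∀ g, T g = T 1 * g}
  mul_mem' := by
    rintro S T ⟨hS, hS', hS''⟩ ⟨hT, hT', hT''⟩
    have e : (S * T) 1 = S 1 * T 1 := hS'' _
    refine ⟨?_, fun b hb => ?_, fun g => ?_⟩
    · rw [e]; exact h.even_mul_even _ hS _ hT
    · rw [e, h.even_assoc _ hS, hT' b hb, ← h.even_assoc _ hS, hS' b hb, h.even_assoc _ hb]
    · rw [e, h.even_assoc _ hS, ← hT'', ← hS'']; rfl
  add_mem' := by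
    rintro S T ⟨hS, hS', hS''⟩ ⟨hT, hT', hT''⟩
    refine ⟨add_mem hS hT, fun b hb => ?_, fun g => ?_⟩
    · rw [LinearMap.add_apply, add_mul, mul_add, hS' b hb, hT' b hb]
    · rw [LinearMap.add_apply, LinearMap.add_apply, add_mul, ← hS'', ← hT'']
  algebraMap_mem' r := by
    refine ⟨even.smul_mem r h.one_mem, fun b hb => ?_, fun g => ?_⟩
    · simp
    · simp

theorem centralMul_comm (h : IsGammaAlgebra even odd) (S T : h.centralMul) : S * T = T * S := by
  obtain ⟨S, hS, hS', hS''⟩ := S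
  obtain ⟨T, hT, hT', hT''⟩ := T
  refine Subtype.ext (LinearMap.ext fun g => ?_)
  change S (T g) = T (S g)
  rw [hT'' g, hS'', hS'' g, hT'' (S 1 * g), ← h.even_assoc _ hS, ← h.even_assoc _ hT, hS' _ hT]

/-- This makes `centralMul` an admissible target for `grLift`. -/
instance (h : IsGammaAlgebra even odd) : CommRing h.centralMul :=
  { (inferInstance : Ring h.centralMul) with mul_comm := h.centralMul_comm }

theorem odd_mul_neg (h : IsGammaAlgebra even odd) {x y : H} (hx : x ∈ odd) (hy : y ∈ odd) :
    x * y = - (y * x) := eq_neg_of_add_eq_zero_left (h.odd_anticomm x hx y hy)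

/-- The associator is only known to vanish with the even element on the left, so skew-symmetry is
used twice: `x(ay) = -(ay)x = -a(yx) = a(xy)`. -/
theorem odd_mul_even_mul_odd (h : IsGammaAlgebra even odd) {a x y : H} (ha : a ∈ even)
    (hx : x ∈ odd) (hy : y ∈ odd) : x * (a * y) = a * (x * y) := by
  rw [h.odd_mul_neg hx (h.even_mul_odd a ha y hy), h.even_assoc a ha, h.odd_mul_neg hx hy,
    mul_neg]

/-- Multiply the Jacobi identity for `v, w, z` on the left by `u`, pull the even factors out to get
`(vw)(uz) + (wz)(uv) + (zv)(uw) = 0`, and commute the products by centrality. -/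
theorem odd_plucker (h : IsGammaAlgebra even odd) {u v w z : H} (hu : u ∈ odd) (hv : v ∈ odd)
    (hw : w ∈ odd) (hz : z ∈ odd) :
    (u * v) * (w * z) + (u * w) * (z * v) + (u * z) * (v * w) = 0 := by
  have e := congrArg (fun t => u * t) (h.odd_jacobi v hv w hw z hz)
  simp only [mul_add, mul_zero] at e
  rw [h.odd_mul_even_mul_odd (h.odd_mul_odd v hv w hw) hu hz,
    h.odd_mul_even_mul_odd (h.odd_mul_odd w hw z hz) hu hv,
    h.odd_mul_even_mul_odd (h.odd_mul_odd z hz v hv) hu hw,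
    h.odd_mul_odd_comm v hv w hw _ (h.odd_mul_odd u hu z hz),
    h.odd_mul_odd_comm w hw z hz _ (h.odd_mul_odd u hu v hv),
    h.odd_mul_odd_comm z hz v hv _ (h.odd_mul_odd u hu w hw)] at e
  rw [← e]; abel

theorem mulLeft_mem_centralMul (h : IsGammaAlgebra even odd) {x y : H} (hx : x ∈ odd)
    (hy : y ∈ odd) : LinearMap.mulLeft F (x * y) ∈ h.centralMul := by
  refine ⟨?_, fun b hb => ?_, fun g => ?_⟩
  · simpa using h.odd_mul_odd x hx y hy
  · simpa using h.odd_mul_odd_comm x hx y hy b hb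
  · simp

/-- The bilinear map `(u, v) ↦ φ(u)φ(v)`, the products being regarded as left multiplications. -/
def centralForm (h : IsGammaAlgebra even odd) (φ : V →ₗ[F] H) (hφ : ∀ v, φ v ∈ odd) :
    V →ₗ[F] V →ₗ[F] h.centralMul :=
  LinearMap.mk₂ F (fun u v => ⟨LinearMap.mulLeft F (φ u * φ v),
      h.mulLeft_mem_centralMul (hφ u) (hφ v)⟩)
    (fun u u' v => Subtype.ext (LinearMap.ext fun g => by simp [add_mul]))
    (fun c u v => Subtype.ext (LinearMap.ext fun g => by simp [smul_mul_assoc]))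
    (fun u u' v => Subtype.ext (LinearMap.ext fun g => by simp [add_mul, mul_add]))
    (fun c u v => Subtype.ext (LinearMap.ext fun g => by
      simp [smul_mul_assoc, mul_smul_comm]))

/-- A linear map `φ` of `V` into the odd part of a `Γ`-algebra `H` makes `F[Gr(2, V)]` act on `H` by
multiplications by central even elements, `u ∧ v` acting as `φ(u)φ(v)`. -/
theorem exists_grCoord_action (h : IsGammaAlgebra even odd) (φ : V →ₗ[F] H)
    (hφ : ∀ v, φ v ∈ odd) :
    ∃ θ : GrCoord F V →ₐ[F] Module.End F H, (∀ a, θ a ∈ h.centralMul) ∧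
      ∀ u v g, θ (grWedge F V u v) g = φ u * φ v * g := by
  refine ⟨h.centralMul.val.comp (grLift (h.centralForm φ hφ)
    (fun u => Subtype.ext (LinearMap.ext fun g => ?_))
    (fun u v w z => Subtype.ext (LinearMap.ext fun g => ?_))), fun a => Subtype.property _,
    fun u v g => ?_⟩
  · change φ u * φ u * g = 0
    rw [h.odd_sq _ (hφ u), zero_mul]
  · change φ u * φ v * (φ w * φ z * g) + φ u * φ w * (φ z * φ v * g)
      + φ u * φ z * (φ v * φ w * g) = 0
    rw [← h.even_assoc _ (h.odd_mul_odd _ (hφ u) _ (hφ v)),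
      ← h.even_assoc _ (h.odd_mul_odd _ (hφ u) _ (hφ w)),
      ← h.even_assoc _ (h.odd_mul_odd _ (hφ u) _ (hφ z)), ← add_mul, ← add_mul,
      h.odd_plucker (hφ u) (hφ v) (hφ w) (hφ z), zero_mul]
  · rw [AlgHom.comp_apply, grLift_grWedge]
    rfl

/-- The extension of `φ` to `F[Gr(2, V)]₁`, for a compatible action of `F[Gr(2, V)]` on `H`. -/
theorem exists_grOdd_lift (h : IsGammaAlgebra even odd) (φ : V →ₗ[F] H) (hφ : ∀ v, φ v ∈ odd)
    [Module (GrCoord F V) H] [IsScalarTower F (GrCoord F V) H]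
    (hw : ∀ (u v : V) (g : H), grWedge F V u v • g = φ u * φ v * g) :
    ∃ ψ : GrOdd F V →ₗ[GrCoord F V] H, ∀ a u, ψ (grOddMk F V a u) = a • φ u := by
  refine ⟨(ordinaryPlucker (grWedge F V)).liftQ (LinearMap.liftBaseChange (GrCoord F V) φ) ?_,
    fun a u => ?_⟩
  · rw [ordinaryPlucker, Submodule.span_le]
    rintro _ ⟨u, v, w, rfl⟩
    rw [SetLike.mem_coe, LinearMap.mem_ker]
    simp only [map_add, LinearMap.liftBaseChange_tmul, hw]
    exact h.odd_jacobi _ (hφ u) _ (hφ v) _ (hφ w)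
  · simp [grOddMk]

/-- The map is `(a, m) ↦ θ(a)1 + ψ(m)`, with `θ` the action on `H` and `ψ` the odd lift. The main
point is its multiplicativity on odd elements, which reduces to `(a φ(u))(b φ(v)) = ab (φ(u) φ(v))`
on pure tensors. -/
theorem exists_freeGamma_lift (h : IsGammaAlgebra even odd) (φ : V →ₗ[F] H)
    (hφ : ∀ v, φ v ∈ odd) :
    ∃ f : FreeGamma F V →ₙₐ[F] H, f 1 = 1 ∧ (∀ v, f (freeGammaι F V v) = φ v) ∧
      (∀ a ∈ GammaExt.evenPart F (grOddForm F V), f a ∈ even) ∧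
      (∀ x ∈ GammaExt.oddPart F (grOddForm F V), f x ∈ odd) := by
  obtain ⟨θ, hθ, hθ'⟩ := h.exists_grCoord_action φ hφ
  let _ : Module (GrCoord F V) H := Module.compHom H θ.toRingHom
  have smul_def : ∀ (a : GrCoord F V) (g : H), a • g = θ a g := fun _ _ => rfl
  have : IsScalarTower F (GrCoord F V) H := ⟨fun c a g => by
    rw [smul_def, smul_def, map_smul]; rfl⟩
  obtain ⟨ψ, hψ⟩ := h.exists_grOdd_lift φ hφ fun u v g => hθ' u v g
  have he : ∀ a, θ a 1 ∈ even := fun a => (hθ a).1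
  have hs : ∀ a g, a • g = θ a 1 * g := fun a g => (hθ a).2.2 g
  have ho : ∀ m, ψ m ∈ odd := fun m => by
    induction m using grOdd_induction with
    | zero => rw [map_zero]; exact zero_mem _
    | mk a u => rw [hψ, hs]; exact h.even_mul_odd _ (he a) _ (hφ u)
    | add x y hx hy => rw [map_add]; exact add_mem hx hy
  have hm : ∀ a b, θ (a * b) 1 = θ a 1 * θ b 1 := fun a b => by
    rw [map_mul]; exact hs a _
  have hβ : ∀ m m', ψ m * ψ m' = θ (grOddForm F V m m') 1 := fun m m' => by
    induction m using grOdd_induction with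
    | zero => simp
    | add x y hx hy => rw [map_add, map_add, add_mul, hx, hy, LinearMap.add_apply, map_add]; rfl
    | mk a u =>
      induction m' using grOdd_induction with
      | zero => simp
      | add x y hx hy => rw [map_add, map_add, mul_add, hx, hy, map_add]; rfl
      | mk b v =>
        rw [hψ, hψ, hs, hs, grOddForm_mk, hm, hm, hθ', mul_one, h.even_assoc _ (he a),
          h.odd_mul_even_mul_odd (he b) (hφ u) (hφ v), h.even_assoc _ (he a)]
  have hψF : ∀ (c : F) m, ψ (c • m) = c • ψ m := fun c m => by
    rw [← algebraMap_smul (GrCoord F V) c m, map_smul, algebraMap_smul]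
  refine ⟨{ toFun := fun x => θ x.1 1 + ψ x.2, map_smul' := ?_, map_zero' := ?_, map_add' := ?_,
            map_mul' := ?_ }, ?_, ?_, ?_, ?_⟩
  · intro c x
    change θ (c • x.1) 1 + ψ (c • x.2) = c • (θ x.1 1 + ψ x.2)
    rw [map_smul, hψF, smul_add]; rfl
  · change θ 0 1 + ψ 0 = 0
    simp
  · intro x y
    change θ (x.1 + y.1) 1 + ψ (x.2 + y.2) = (θ x.1 1 + ψ x.2) + (θ y.1 1 + ψ y.2)
    rw [map_add, map_add, LinearMap.add_apply]; abel
  · intro x y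
    change θ (x.1 * y.1 + grOddForm F V x.2 y.2) 1 + ψ (x.1 • y.2 + y.1 • x.2)
      = (θ x.1 1 + ψ x.2) * (θ y.1 1 + ψ y.2)
    rw [map_add, LinearMap.add_apply, hm, ← hβ, map_add, map_smul, map_smul, hs, hs, mul_add,
      add_mul, add_mul, h.even_comm_odd _ (he y.1) _ (ho x.2)]
    abel
  · change θ 1 1 + ψ 0 = 1
    simp
  · intro v
    change θ 0 1 + ψ (grOddMk F V 1 v) = φ v
    rw [hψ]; simp
  · intro a ha
    rw [GammaExt.mem_evenPart] at ha
    change θ a.1 1 + ψ a.2 ∈ even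
    rw [ha, map_zero, add_zero]; exact he _
  · intro a ha
    rw [GammaExt.mem_oddPart] at ha
    change θ a.1 1 + ψ a.2 ∈ odd
    rw [ha, map_zero, LinearMap.zero_apply, zero_add]; exact ho _

end IsGammaAlgebra

end Lift

theorem isFreeGammaAlgebra_freeGamma (F : Type u) (V : Type v) [Field F] [AddCommGroup V]
    [Module F V] :
    IsFreeGammaAlgebra.{w} (GammaExt.evenPart F (grOddForm F V))
      (GammaExt.oddPart F (grOddForm F V)) (freeGammaι F V) := by
  refine ⟨isGammaAlgebra_freeGamma F V, fun v => ⟨_, rfl⟩, ?_⟩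
  intro H _ _ _ _ even' odd' h φ hφ
  obtain ⟨f, h1, hι, he, ho⟩ := h.exists_freeGamma_lift φ hφ
  refine ⟨f, h1, hι, he, ho, fun f' h1' hι' => NonUnitalAlgHom.ext fun x => ?_⟩
  have hx : x ∈ NonUnitalAlgebra.adjoin F ({1} ∪ Set.range (freeGammaι F V)) := by
    rw [adjoin_freeGammaι]; trivial
  induction hx using NonUnitalAlgebra.adjoin_induction with
  | mem x hx =>
    rcases hx with rfl | ⟨v, rfl⟩
    · rw [h1, h1']
    · rw [hι, hι']
  | zero => rw [map_zero, map_zero]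
  | add x y _ _ hx hy => rw [map_add, map_add, hx, hy]
  | mul x y _ _ hx hy => rw [map_mul, map_mul, hx, hy]
  | smul c x _ hx => rw [map_smul, map_smul, hx]


/-! ### Straightening by the Plücker relations. -/

section Straightening

variable {n : ℕ}

/-- The sum of the squares `(j - i)²` over the pairs `(i, j)` of a multiset. -/
def spread (s : Multiset (Fin n × Fin n)) : ℕ :=
  (s.map fun p => ((p.2 : ℕ) - (p.1 : ℕ)) ^ 2).sum

theorem spread_cons (p : Fin n × Fin n) (s : Multiset (Fin n × Fin n)) :
    spread (p ::ₘ s) = ((p.2 : ℕ) - (p.1 : ℕ)) ^ 2 + spread s := by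
  simp [spread]

/-- Pairs that are incomparable in the product order are strictly nested as intervals. -/
theorem exists_nested_of_not_chain {s : Multiset (Fin n × Fin n)}
    (h : ¬ ∀ p ∈ s, ∀ q ∈ s, p ≤ q ∨ q ≤ p) :
    ∃ (i j k l : Fin n) (t : Multiset (Fin n × Fin n)), i < k ∧ l < j ∧
      s = (i, j) ::ₘ (k, l) ::ₘ t := by
  push Not at h
  obtain ⟨p, hp, q, hq, h₁, h₂⟩ := h
  have hne : p ≠ q := by rintro rfl; exact h₁ le_rfl
  wlog h₃ : p.1 < q.1 generalizing p q
  · refine this q hq p hp h₂ h₁ hne.symm (lt_of_not_ge fun h₄ => ?_)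
    have h₅ : p.1 = q.1 := le_antisymm h₄ (not_lt.1 h₃)
    rcases le_total p.2 q.2 with h₆ | h₆
    · exact h₁ ⟨h₅.le, h₆⟩
    · exact h₂ ⟨h₅.ge, h₆⟩
  have h₄ : q.2 < p.2 := lt_of_not_ge fun h₄ => h₁ ⟨h₃.le, h₄⟩
  obtain ⟨t, rfl⟩ := Multiset.exists_cons_of_mem hp
  obtain ⟨t, rfl⟩ := Multiset.exists_cons_of_mem ((Multiset.mem_cons.1 hq).resolve_left hne.symm)
  exact ⟨p.1, p.2, q.1, q.2, t, h₃, h₄, rfl⟩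

/-- On a chain for the product order, `i + j` is strictly increasing, so sorting by this sum sorts
both coordinates at once. -/
theorem exists_stdIndex {s : Multiset (Fin n × Fin n)} (hs : ∀ p ∈ s, p.1 < p.2)
    (h : ∀ p ∈ s, ∀ q ∈ s, p ≤ q ∨ q ≤ p) : ∃ l : StdIndex n, (l.1 : Multiset _) = s := by
  obtain ⟨l, rfl⟩ := Quot.exists_rep s
  let r : Fin n × Fin n → Fin n × Fin n → Prop :=
    fun p q => (p.1 : ℕ) + (p.2 : ℕ) ≤ (q.1 : ℕ) + (q.2 : ℕ)
  have : Std.Total r := ⟨fun p q => le_total _ _⟩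
  have : IsTrans _ r := ⟨fun p q t => le_trans⟩
  have : DecidableRel r := fun p q => inferInstanceAs (Decidable (_ ≤ _))
  have hperm := List.perm_insertionSort r l
  refine ⟨⟨l.insertionSort r, fun p hp => hs p (hperm.mem_iff.1 hp), ?_⟩,
    Quot.sound hperm⟩
  refine List.Pairwise.imp_of_mem ?_ (List.pairwise_insertionSort r l)
  intro p q hp hq hpq
  have hpq' : (p.1 : ℕ) + (p.2 : ℕ) ≤ (q.1 : ℕ) + (q.2 : ℕ) := hpq
  rcases h p (hperm.mem_iff.1 hp) q (hperm.mem_iff.1 hq) with h | h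
  · exact h
  · have h₁ : (q.1 : ℕ) ≤ p.1 := h.1
    have h₂ : (q.2 : ℕ) ≤ p.2 := h.2
    constructor <;> rw [Fin.le_def] <;> omega

variable {R : Type*} [CommRing R] (ω : Fin n → Fin n → R)

/-- The product of the `ω(i, j)` over the pairs `(i, j)` of a multiset. -/
def pairProd (s : Multiset (Fin n × Fin n)) : R := (s.map fun p => ω p.1 p.2).prod

theorem pairProd_cons (p : Fin n × Fin n) (s : Multiset (Fin n × Fin n)) :
    pairProd ω (p ::ₘ s) = ω p.1 p.2 * pairProd ω s := by
  simp [pairProd]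

/-- With gaps `a, b, c` between consecutive points, the nested pair has lengths `a + b + c` and `b`.
The crossing pair has lengths `a + b` and `b + c`, of the same sum but less uneven; the disjoint
pair has only `a` and `c`. -/
theorem nested_spread_lt {i k l j : ℕ} (h₁ : i < k) (h₂ : k < l) (h₃ : l < j) :
    (l - i) ^ 2 + (j - k) ^ 2 < (j - i) ^ 2 + (l - k) ^ 2 ∧
      (k - i) ^ 2 + (j - l) ^ 2 < (j - i) ^ 2 + (l - k) ^ 2 := by
  obtain ⟨p, rfl⟩ := Nat.exists_eq_add_of_lt h₁
  obtain ⟨q, rfl⟩ := Nat.exists_eq_add_of_lt h₂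
  obtain ⟨r, rfl⟩ := Nat.exists_eq_add_of_lt h₃
  rw [show i + p + 1 + q + 1 - i = p + q + 2 by omega,
    show i + p + 1 + q + 1 + r + 1 - (i + p + 1) = q + r + 2 by omega,
    show i + p + 1 + q + 1 + r + 1 - i = p + q + r + 3 by omega,
    show i + p + 1 + q + 1 - (i + p + 1) = q + 1 by omega,
    show i + p + 1 - i = p + 1 by omega,
    show i + p + 1 + q + 1 + r + 1 - (i + p + 1 + q + 1) = r + 1 by omega]
  constructor <;> nlinarith [Nat.zero_le (p * r), Nat.zero_le (p * q), Nat.zero_le (q * r)]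

/-- An odd generator `e_m` is counted as the pair `(-1, m)`, of squared length `(m + 1)²`. Then
`ω(i, k) e_j` with `k < j` is again a nested configuration, and the inequalities are the analogues
of `nested_spread_lt`. -/
theorem odd_spread_lt {i k j : ℕ} (h₁ : i < k) (h₂ : k < j) :
    (j - i) ^ 2 + (k + 1) ^ 2 < (k - i) ^ 2 + (j + 1) ^ 2 ∧
      (j - k) ^ 2 + (i + 1) ^ 2 < (k - i) ^ 2 + (j + 1) ^ 2 := by
  obtain ⟨p, rfl⟩ := Nat.exists_eq_add_of_lt h₁
  obtain ⟨q, rfl⟩ := Nat.exists_eq_add_of_lt h₂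
  rw [show i + p + 1 + q + 1 - i = p + q + 2 by omega, show i + p + 1 - i = p + 1 by omega,
    show i + p + 1 + q + 1 - (i + p + 1) = q + 1 by omega]
  constructor <;> nlinarith [Nat.zero_le (p * i), Nat.zero_le (p * q), Nat.zero_le (q * i)]

variable {ω}

/-- One straightening step. -/
theorem exists_straightening (h₁ : ∀ i j, ω i j = - ω j i)
    (h₂ : ∀ i j k l, ω i j * ω k l + ω i k * ω l j + ω i l * ω j k = 0)
    {s : Multiset (Fin n × Fin n)} (hs : ∀ p ∈ s, p.1 < p.2)
    (h : ¬ ∀ p ∈ s, ∀ q ∈ s, p ≤ q ∨ q ≤ p) :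
    ∃ s₁ s₂ : Multiset (Fin n × Fin n), (∀ p ∈ s₁, p.1 < p.2) ∧ (∀ p ∈ s₂, p.1 < p.2) ∧
      spread s₁ < spread s ∧ spread s₂ < spread s ∧
      pairProd ω s = pairProd ω s₁ - pairProd ω s₂ := by
  obtain ⟨i, j, k, l, t, hik, hlj, rfl⟩ := exists_nested_of_not_chain h
  simp only [Multiset.mem_cons, forall_eq_or_imp] at hs
  obtain ⟨hij, hkl, ht⟩ := hs
  have hm := nested_spread_lt (Fin.lt_def.1 hik) (Fin.lt_def.1 hkl) (Fin.lt_def.1 hlj)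
  -- For `i < k < l < j` the double Plücker relation reads nested = crossing − disjoint: `ω(i, j)
  -- ω(k, l) = ω(i, l) ω(k, j) - ω(i, k) ω(l, j)`.
  refine ⟨(i, l) ::ₘ (k, j) ::ₘ t, (i, k) ::ₘ (l, j) ::ₘ t, ?_, ?_, ?_, ?_, ?_⟩
  · simp only [Multiset.mem_cons, forall_eq_or_imp]
    exact ⟨hik.trans hkl, hkl.trans hlj, ht⟩
  · simp only [Multiset.mem_cons, forall_eq_or_imp]
    exact ⟨hik, hlj, ht⟩
  · simp only [spread_cons]; omega
  · simp only [spread_cons]; omega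
  · simp only [pairProd_cons]
    linear_combination (pairProd ω t) * h₂ i j k l - (pairProd ω t * ω i l) * h₁ j k

variable (F : Type*) [Field F]

/-- The standard monomials span the space spanned by all monomials in the `ω(i, j)`. -/
theorem pairProd_mem_span [Algebra F R] (h₁ : ∀ i j, ω i j = - ω j i)
    (h₂ : ∀ i j k l, ω i j * ω k l + ω i k * ω l j + ω i l * ω j k = 0)
    (s : Multiset (Fin n × Fin n)) (hs : ∀ p ∈ s, p.1 < p.2) :
    pairProd ω s ∈ Submodule.span F (Set.range fun l : StdIndex n => pairProd ω l.1) := by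
  induction hN : spread s using Nat.strong_induction_on generalizing s with
  | _ N ih =>
    subst hN
    by_cases h : ∀ p ∈ s, ∀ q ∈ s, p ≤ q ∨ q ≤ p
    · obtain ⟨l, rfl⟩ := exists_stdIndex hs h
      exact Submodule.subset_span ⟨l, rfl⟩
    · obtain ⟨s₁, s₂, hs₁, hs₂, hl₁, hl₂, e⟩ := exists_straightening h₁ h₂ hs h
      rw [e]
      exact sub_mem (ih _ hl₁ s₁ hs₁ rfl) (ih _ hl₂ s₂ hs₂ rfl)

/-- The standard odd elements span the space spanned by all products of a monomial in the `ω(i, j)`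
and some `e_m`. -/
theorem pairProd_smul_mem_span {M : Type*} [AddCommGroup M] [Module R M] [Module F M]
    {e : Fin n → M} (h₁ : ∀ i j, ω i j = - ω j i)
    (h₂ : ∀ i j k l, ω i j * ω k l + ω i k * ω l j + ω i l * ω j k = 0)
    (h₃ : ∀ i j k, ω i j • e k + ω j k • e i + ω k i • e j = 0)
    (s : Multiset (Fin n × Fin n)) (hs : ∀ p ∈ s, p.1 < p.2) (m : Fin n) :
    pairProd ω s • e m ∈ Submodule.span F
      (Set.range fun x : Σ j : Fin n, StdIndexGE j => pairProd ω x.2.1.1 • e x.1) := by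
  induction hN : spread s + (m + 1) ^ 2 using Nat.strong_induction_on generalizing s m with
  | _ N ih =>
    subst hN
    by_cases h : ∀ p ∈ s, ∀ q ∈ s, p ≤ q ∨ q ≤ p
    · by_cases h' : ∀ p ∈ s, m ≤ p.2
      · obtain ⟨l, rfl⟩ := exists_stdIndex hs h
        exact Submodule.subset_span ⟨⟨m, l, h'⟩, rfl⟩
      · push Not at h'
        obtain ⟨⟨i, k⟩, hp, hkm⟩ := h'
        obtain ⟨t, rfl⟩ := Multiset.exists_cons_of_mem hp
        simp only [Multiset.mem_cons, forall_eq_or_imp] at hs hkm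
        obtain ⟨hik, ht⟩ := hs
        have hm := odd_spread_lt (Fin.lt_def.1 hik) (Fin.lt_def.1 hkm)
        -- The ordinary Plücker relation solved for the bad term: `ω(i, k) e_m = ω(i, m) e_k - ω(k,
        -- m) e_i`.
        have e' : pairProd ω ((i, k) ::ₘ t) • e m =
            pairProd ω ((i, m) ::ₘ t) • e k - pairProd ω ((k, m) ::ₘ t) • e i := by
          have h₄ := congrArg (fun x : M => pairProd ω t • x) (h₃ i k m)
          rw [h₁ m i] at h₄
          simp only [smul_add, smul_zero, neg_smul, smul_neg, smul_smul] at h₄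
          simp only [pairProd_cons, mul_comm _ (pairProd ω t)]
          rw [← sub_eq_zero, ← h₄]; abel
        rw [e']
        refine sub_mem (ih _ ?_ _ ?_ _ rfl) (ih _ ?_ _ ?_ _ rfl)
        · simp only [spread_cons]; omega
        · simp only [Multiset.mem_cons, forall_eq_or_imp]; exact ⟨hik.trans hkm, ht⟩
        · simp only [spread_cons]; omega
        · simp only [Multiset.mem_cons, forall_eq_or_imp]; exact ⟨hkm, ht⟩
    · obtain ⟨s₁, s₂, hs₁, hs₂, hl₁, hl₂, e⟩ := exists_straightening h₁ h₂ hs h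
      rw [e, sub_smul]
      exact sub_mem (ih _ (by omega) s₁ hs₁ m rfl) (ih _ (by omega) s₂ hs₂ m rfl)

/-- If the `ω(i, j)` generate the algebra `R`, the monomials in the `ω(i, j)`, `i < j`, span it. -/
theorem span_pairProd_eq_top [Algebra F R] (h₀ : ∀ i, ω i i = 0) (h₁ : ∀ i j, ω i j = - ω j i)
    (hgen : Algebra.adjoin F {a | ∃ i j, a = ω i j} = ⊤) :
    Submodule.span F {a | ∃ s : Multiset (Fin n × Fin n), (∀ p ∈ s, p.1 < p.2) ∧
      a = pairProd ω s} = ⊤ := by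
  have hlt : ∀ i j, i < j → ω i j ∈ Algebra.adjoin F {a | ∃ i j, i < j ∧ a = ω i j} :=
    fun i j h => Algebra.subset_adjoin ⟨i, j, h, rfl⟩
  have h : Algebra.adjoin F {a | ∃ i j, i < j ∧ a = ω i j} = ⊤ := by
    refine eq_top_iff.2 (hgen ▸ Algebra.adjoin_le ?_)
    rintro _ ⟨i, j, rfl⟩
    rcases lt_trichotomy i j with h | rfl | h
    · exact hlt i j h
    · rw [SetLike.mem_coe, h₀]; exact zero_mem _
    · rw [SetLike.mem_coe, h₁]; exact neg_mem (hlt j i h)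
  rw [eq_top_iff, ← Algebra.top_toSubmodule, ← h, Algebra.adjoin_eq_span]
  refine Submodule.span_mono fun a ha => ?_
  induction ha using Submonoid.closure_induction with
  | mem x hx => obtain ⟨i, j, hij, rfl⟩ := hx; exact ⟨{(i, j)}, by simpa, by simp [pairProd]⟩
  | one => exact ⟨0, by simp, by simp [pairProd]⟩
  | mul x y _ _ hx hy =>
    obtain ⟨s, hs, rfl⟩ := hx
    obtain ⟨t, ht, rfl⟩ := hy
    exact ⟨s + t, fun p hp => (Multiset.mem_add.1 hp).elim (hs p) (ht p), by simp [pairProd]⟩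

end Straightening

/-! ### The standard elements span `Γ[∅; Fⁿ]`. -/

section FreeSpan

variable (F : Type*) [Field F] (n : ℕ)

/-- The element `e_i ∧ e_j` of `F[Gr(2, Fⁿ)]`. -/
def grPair (i j : Fin n) : GrCoord F (Fin n → F) :=
  grWedge F (Fin n → F) (Pi.single i 1) (Pi.single j 1)

theorem pi_single_span_induction {p : (Fin n → F) → Prop} (zero : p 0)
    (add : ∀ u v, p u → p v → p (u + v)) (smul : ∀ (c : F) u, p u → p (c • u))
    (single : ∀ i, p (Pi.single i 1)) (u : Fin n → F) : p u := by
  rw [← (Pi.basisFun F (Fin n)).sum_repr u]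
  refine Finset.sum_induction _ p add zero fun i _ => smul _ _ ?_
  rw [Pi.basisFun_apply]; exact single i

theorem adjoin_grPair :
    Algebra.adjoin F {a | ∃ i j, a = grPair F n i j} = ⊤ := by
  rw [eq_top_iff, ← adjoin_grWedge F (Fin n → F)]
  refine Algebra.adjoin_le ?_
  rintro _ ⟨u, v, rfl⟩
  rw [SetLike.mem_coe]
  induction u using pi_single_span_induction with
  | zero => simp
  | add u u' h h' => rw [map_add, LinearMap.add_apply]; exact add_mem h h'
  | smul c u h => rw [map_smul, LinearMap.smul_apply]; exact Subalgebra.smul_mem _ h c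
  | single i =>
    induction v using pi_single_span_induction with
    | zero => simp
    | add u u' h h' => rw [map_add]; exact add_mem h h'
    | smul c u h => rw [map_smul]; exact Subalgebra.smul_mem _ h c
    | single j => exact Algebra.subset_adjoin ⟨i, j, rfl⟩

/-- The standard elements of `Γ[∅; Fⁿ]`. -/
def freeStd : StdIndex n ⊕ (Σ j : Fin n, StdIndexGE j) → FreeGamma F (Fin n → F) :=
  Sum.elim (fun l => GammaExt.inEven F (grOddForm F (Fin n → F)) (pairProd (grPair F n) l.1))
    (fun x => GammaExt.inEven F (grOddForm F (Fin n → F)) (pairProd (grPair F n) x.2.1.1) *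
      freeGammaι F (Fin n → F) (Pi.single x.1 1))

/-- Straightening needs only skew-symmetry and the two families of Plücker relations, which hold in
`Γ[∅; Fⁿ]` by construction. Independence is left to the images in `Γ(A_n)`. -/
theorem span_freeStd : Submodule.span F (Set.range (freeStd F n)) = ⊤ := by
  have h₀ : ∀ i, grPair F n i i = 0 := fun i => grWedge_self F _ _
  have h₁ : ∀ i j, grPair F n i j = - grPair F n j i := fun i j => grWedge_swap F _ _ _
  have h₂ : ∀ i j k l, grPair F n i j * grPair F n k l + grPair F n i k * grPair F n l j
    + grPair F n i l * grPair F n j k = 0 := fun i j k l => grWedge_plucker F _ _ _ _ _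
  have h₃ : ∀ i j k, grPair F n i j • grOddMk F (Fin n → F) 1 (Pi.single k 1)
      + grPair F n j k • grOddMk F (Fin n → F) 1 (Pi.single i 1)
      + grPair F n k i • grOddMk F (Fin n → F) 1 (Pi.single j 1) = 0 := fun i j k => by
    simp only [smul_grOddMk, mul_one]
    exact grOdd_plucker _ _ _
  have htop := span_pairProd_eq_top F h₀ h₁ (adjoin_grPair F n)
  set S := Submodule.span F (Set.range (freeStd F n))
  have he : ∀ a, GammaExt.inEven F (grOddForm F (Fin n → F)) a ∈ S := fun a => by
    have ha : a ∈ Submodule.span F {a | ∃ s : Multiset (Fin n × Fin n), (∀ p ∈ s, p.1 < p.2) ∧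
      a = pairProd (grPair F n) s} := by rw [htop]; trivial
    suffices hle : Submodule.span F {a | ∃ s : Multiset (Fin n × Fin n), (∀ p ∈ s, p.1 < p.2) ∧
      a = pairProd (grPair F n) s} ≤ S.comap (GammaExt.inEven F (grOddForm F (Fin n → F))) from
      hle ha
    refine Submodule.span_le.2 ?_
    rintro _ ⟨s, hs, rfl⟩
    refine Submodule.span_le.2 ?_ (pairProd_mem_span F h₁ h₂ s hs)
    rintro _ ⟨l, rfl⟩
    exact Submodule.subset_span ⟨Sum.inl l, rfl⟩
  have ho : ∀ m, GammaExt.inOdd F (grOddForm F (Fin n → F)) m ∈ S := fun m => by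
    induction m using grOdd_induction with
    | zero => rw [map_zero]; exact zero_mem _
    | add x y hx hy => rw [map_add]; exact add_mem hx hy
    | mk a u =>
      induction u using pi_single_span_induction with
      | zero => rw [grOddMk, TensorProduct.tmul_zero, map_zero, map_zero]; exact zero_mem _
      | add u v hu hv => rw [grOddMk_add_right, map_add]; exact add_mem hu hv
      | smul c u hu => rw [grOddMk_smul_right, map_smul]; exact S.smul_mem c hu
      | single m =>
        have ha : a ∈ Submodule.span F {a | ∃ s : Multiset (Fin n × Fin n),
          (∀ p ∈ s, p.1 < p.2) ∧ a = pairProd (grPair F n) s} := by rw [htop]; trivial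
        induction ha using Submodule.span_induction with
        | zero => rw [grOddMk, TensorProduct.zero_tmul, map_zero, map_zero]; exact zero_mem _
        | add a b _ _ ha hb => rw [grOddMk_add_left, map_add]; exact add_mem ha hb
        | smul c a _ ha =>
          rw [← inEven_mul_freeGammaι, map_smul, smul_mul_assoc, inEven_mul_freeGammaι]
          exact S.smul_mem c ha
        | mem a ha =>
          obtain ⟨s, hs, rfl⟩ := ha
          have key := pairProd_smul_mem_span F h₁ h₂ h₃ s hs m
          rw [smul_grOddMk, mul_one] at key
          suffices hle : Submodule.span F (Set.range fun x : Σ j : Fin n, StdIndexGE j =>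
              pairProd (grPair F n) x.2.1.1 • grOddMk F (Fin n → F) 1 (Pi.single x.1 1)) ≤
              S.comap (GammaExt.inOdd F (grOddForm F (Fin n → F))) from hle key
          refine Submodule.span_le.2 ?_
          rintro _ ⟨x, rfl⟩
          refine Submodule.subset_span ⟨Sum.inr x, ?_⟩
          change GammaExt.inEven F (grOddForm F (Fin n → F)) (pairProd (grPair F n) x.2.1.1) *
            freeGammaι F (Fin n → F) (Pi.single x.1 1) = GammaExt.inOdd F
            (grOddForm F (Fin n → F)) (pairProd (grPair F n) x.2.1.1 •
              grOddMk F (Fin n → F) 1 (Pi.single x.1 1))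
          rw [inEven_mul_freeGammaι, smul_grOddMk, mul_one]
  refine eq_top_iff.2 fun x _ => ?_
  rw [GammaExt.eq_inEven_add_inOdd (F := F) x]
  exact add_mem (he _) (ho _)

end FreeSpan


/-! ### Leading monomials with respect to a weight. -/

section Leading

open MvPolynomial

/-- The coefficient of `p` at `e` is `1`, and all other monomials of `p` have smaller weight. -/
def HasLeadingMonomial {σ F : Type*} [CommRing F] (w : (σ →₀ ℕ) →+ ℕ) (p : MvPolynomial σ F)
    (e : σ →₀ ℕ) : Prop :=
  p.coeff e = 1 ∧ ∀ m, p.coeff m ≠ 0 → m ≠ e → w m < w e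

namespace HasLeadingMonomial

variable {σ F : Type*} [CommRing F] {w : (σ →₀ ℕ) →+ ℕ}

theorem le {p : MvPolynomial σ F} {e m : σ →₀ ℕ} (h : HasLeadingMonomial w p e)
    (hm : p.coeff m ≠ 0) : w m ≤ w e := by
  by_cases hme : m = e
  · rw [hme]
  · exact (h.2 m hm hme).le

theorem one : HasLeadingMonomial w (1 : MvPolynomial σ F) 0 := by
  classical
  refine ⟨by simp, fun m hm hne => ?_⟩
  rw [coeff_one, if_neg hne.symm] at hm
  exact absurd rfl hm

theorem X (i : σ) : HasLeadingMonomial w (X i : MvPolynomial σ F) (Finsupp.single i 1) := by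
  classical
  refine ⟨by simp, fun m hm hne => ?_⟩
  rw [coeff_X, if_neg hne.symm] at hm
  exact absurd rfl hm

/-- By additivity of the weight, any other pair of exponents that occurs has a strictly smaller
total weight. So the coefficient at `e + e'` comes from a single term. -/
theorem mul {p q : MvPolynomial σ F} {e e' : σ →₀ ℕ} (hp : HasLeadingMonomial w p e)
    (hq : HasLeadingMonomial w q e') : HasLeadingMonomial w (p * q) (e + e') := by
  classical
  have key : ∀ a b, p.coeff a ≠ 0 → q.coeff b ≠ 0 → (a, b) ≠ (e, e') →
      w (a + b) < w (e + e') := fun a b ha hb hne => by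
    rw [map_add, map_add]
    by_cases h : a = e
    · exact add_lt_add_of_le_of_lt (hp.le ha) (hq.2 b hb fun h' => hne (by rw [h, h']))
    · exact add_lt_add_of_lt_of_le (hp.2 a ha h) (hq.le hb)
  constructor
  · rw [coeff_mul, Finset.sum_eq_single (e, e'), hp.1, hq.1, one_mul]
    · rintro ⟨a, b⟩ hab hne
      by_contra h0
      have := key a b (left_ne_zero_of_mul h0) (right_ne_zero_of_mul h0) hne
      rw [Finset.HasAntidiagonal.mem_antidiagonal.1 hab] at this
      exact lt_irrefl _ this
    · simp
  · intro m hm hne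
    rw [coeff_mul] at hm
    obtain ⟨⟨a, b⟩, hab, h0⟩ := Finset.exists_ne_zero_of_sum_ne_zero hm
    rw [← Finset.HasAntidiagonal.mem_antidiagonal.1 hab]
    refine key a b (left_ne_zero_of_mul h0) (right_ne_zero_of_mul h0) fun h => hne ?_
    rw [← Finset.HasAntidiagonal.mem_antidiagonal.1 hab]
    rw [Prod.mk.injEq] at h
    rw [h.1, h.2]

end HasLeadingMonomial

/-- In a nontrivial relation, take an index whose leading exponent has maximal weight: no other
member of the relation contains that monomial. Ties in weight do no harm, as the leading exponents
are distinct. -/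
theorem linearIndependent_of_hasLeadingMonomial {σ F ι : Type*} [CommRing F]
    (w : (σ →₀ ℕ) →+ ℕ) {f : ι → MvPolynomial σ F} {e : ι → σ →₀ ℕ}
    (he : Function.Injective e) (h : ∀ i, HasLeadingMonomial w (f i) (e i)) :
    LinearIndependent F f := by
  rw [linearIndependent_iff]
  intro l hl
  by_contra hne
  obtain ⟨i, hi, hmax⟩ := l.support.exists_max_image (fun i => w (e i))
    (Finsupp.support_nonempty_iff.2 hne)
  have hc := congrArg (coeff (e i)) hl
  rw [Finsupp.linearCombination_apply, Finsupp.sum, coeff_sum, coeff_zero,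
    Finset.sum_eq_single i, coeff_smul, (h i).1, smul_eq_mul, mul_one] at hc
  · exact Finsupp.mem_support_iff.1 hi hc
  · intro k hk hki
    rw [coeff_smul]
    by_contra h0
    exact absurd ((h k).2 (e i) (right_ne_zero_of_mul h0) fun h' => hki (he h').symm)
      (hmax k hk).not_gt
  · exact fun h' => absurd hi h'

end Leading

/-! ### Independence of the standard elements in `Γ(A_n)`. -/

section StandardIndependent

open MvPolynomial

variable {n : ℕ}

/-- The weight giving `x_i` weight `0` and `y_j` weight `j`. -/
def yWeight (n : ℕ) : (Fin n ⊕ Fin n →₀ ℕ) →+ ℕ :=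
  Finsupp.weight (Sum.elim (fun _ : Fin n => 0) fun j : Fin n => (j : ℕ))

theorem yWeight_single_inl (i : Fin n) : yWeight n (Finsupp.single (Sum.inl i) 1) = 0 := by
  simp [yWeight, Finsupp.weight_apply]

theorem yWeight_single_inr (i : Fin n) : yWeight n (Finsupp.single (Sum.inr i) 1) = i := by
  simp [yWeight, Finsupp.weight_apply]

/-- The exponent of `x_i y_j`. -/
def pairExp (p : Fin n × Fin n) : Fin n ⊕ Fin n →₀ ℕ :=
  Finsupp.single (Sum.inl p.1) 1 + Finsupp.single (Sum.inr p.2) 1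

/-- For `i < j`, the term `x_i y_j` has weight `j` and the term `x_j y_i` has weight `i`. -/
theorem alpha_hasLeadingMonomial (F : Type*) [Field F] {p : Fin n × Fin n} (h : p.1 < p.2) :
    HasLeadingMonomial (yWeight n) (alpha F p.1 p.2) (pairExp p) := by
  classical
  have e : ∀ i j : Fin n, (MvPolynomial.X (Sum.inl i) * MvPolynomial.X (Sum.inr j) : PolyA F n) =
      monomial (pairExp (i, j)) 1 := fun i j => by
    rw [X, X, monomial_mul, one_mul, pairExp]
  have hne : pairExp (p.2, p.1) ≠ pairExp p := fun h' => by
    have := DFunLike.congr_fun h' (Sum.inl p.1)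
    simp [pairExp, h.ne'] at this
  rw [alpha, e, e]
  constructor
  · simp [coeff_monomial, hne]
  · intro m hm hmp
    rw [coeff_sub, coeff_monomial, coeff_monomial, if_neg (Ne.symm hmp)] at hm
    have hm' : pairExp (p.2, p.1) = m := by
      by_contra h0
      simp [h0] at hm
    rw [← hm', pairExp, pairExp, map_add, map_add, yWeight_single_inl, yWeight_single_inl,
      yWeight_single_inr, yWeight_single_inr]
    simpa using h

/-- The exponent of `x_{i_1} y_{j_1} ⋯ x_{i_r} y_{j_r}`. -/
def listExp (l : List (Fin n × Fin n)) : Fin n ⊕ Fin n →₀ ℕ := (l.map pairExp).sum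

theorem listExp_inl (l : List (Fin n × Fin n)) (i : Fin n) :
    listExp l (Sum.inl i) = (l.map Prod.fst).count i := by
  induction l with
  | nil => simp [listExp]
  | cons p l ih =>
    simp only [listExp] at ih
    simp only [listExp, List.map_cons, List.sum_cons, Finsupp.add_apply, ih, List.count_cons,
      pairExp, Finsupp.single_apply, beq_iff_eq]
    simp [add_comm]

theorem listExp_inr (l : List (Fin n × Fin n)) (i : Fin n) :
    listExp l (Sum.inr i) = (l.map Prod.snd).count i := by
  induction l with
  | nil => simp [listExp]
  | cons p l ih =>
    simp only [listExp] at ih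
    simp only [listExp, List.map_cons, List.sum_cons, Finsupp.add_apply, ih, List.count_cons,
      pairExp, Finsupp.single_apply, beq_iff_eq]
    simp [add_comm]

theorem eq_of_map_fst_snd {α β : Type*} {l l' : List (α × β)}
    (h₁ : l.map Prod.fst = l'.map Prod.fst) (h₂ : l.map Prod.snd = l'.map Prod.snd) : l = l' := by
  induction l generalizing l' with
  | nil => cases l' <;> simp_all
  | cons p l ih =>
    cases l' with
    | nil => simp at h₁
    | cons q l' =>
      simp only [List.map_cons, List.cons.injEq] at h₁ h₂
      rw [ih h₁.2 h₂.2, Prod.ext h₁.1 h₂.1]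

theorem eq_of_pairwise_le_of_count {l l' : List (Fin n)} (h : l.Pairwise (· ≤ ·))
    (h' : l'.Pairwise (· ≤ ·)) (hc : ∀ i, l.count i = l'.count i) : l = l' :=
  (List.perm_iff_count.2 hc).eq_of_pairwise' h h'

theorem StdIndex.pairwise_fst (l : StdIndex n) : (l.1.map Prod.fst).Pairwise (· ≤ ·) :=
  List.pairwise_map.2 (l.2.2.imp fun h => h.1)

theorem StdIndex.pairwise_snd (l : StdIndex n) : (l.1.map Prod.snd).Pairwise (· ≤ ·) :=
  List.pairwise_map.2 (l.2.2.imp fun h => h.2)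

/-- The exponent records the multisets of the `i_s` and of the `j_s`. Standardness means both
sequences are sorted, so the multisets determine them and their pairing. -/
theorem listExp_injective : Function.Injective fun l : StdIndex n => listExp l.1 := by
  intro l l' h
  refine Subtype.ext (eq_of_map_fst_snd
    (eq_of_pairwise_le_of_count l.pairwise_fst l'.pairwise_fst fun i => ?_)
    (eq_of_pairwise_le_of_count l.pairwise_snd l'.pairwise_snd fun i => ?_))
  · rw [← listExp_inl, ← listExp_inl]; exact DFunLike.congr_fun h _
  · rw [← listExp_inr, ← listExp_inr]; exact DFunLike.congr_fun h _

/-- The condition `j_1 ≥ m` defining `B_{n,m}` makes `m, j_1, …, j_r` sorted, so `m` is recovered as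
the least of the `y`-indices. -/
theorem listExp_add_single_injective : Function.Injective
    fun x : Σ j : Fin n, StdIndexGE j => listExp x.2.1.1 + Finsupp.single (Sum.inr x.1) 1 := by
  rintro ⟨j, l, hl⟩ ⟨j', l', hl'⟩ h
  have h₁ : l.1.map Prod.fst = l'.1.map Prod.fst :=
    eq_of_pairwise_le_of_count l.pairwise_fst l'.pairwise_fst fun i => by
      have := DFunLike.congr_fun h (Sum.inl i)
      simpa [listExp_inl] using this
  have h₂ : j :: l.1.map Prod.snd = j' :: l'.1.map Prod.snd := by
    refine eq_of_pairwise_le_of_count (List.pairwise_cons.2 ⟨?_, l.pairwise_snd⟩)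
      (List.pairwise_cons.2 ⟨?_, l'.pairwise_snd⟩) fun i => ?_
    · intro i hi
      obtain ⟨p, hp, rfl⟩ := List.mem_map.1 hi
      exact hl p hp
    · intro i hi
      obtain ⟨p, hp, rfl⟩ := List.mem_map.1 hi
      exact hl' p hp
    · have := DFunLike.congr_fun h (Sum.inr i)
      simpa [listExp_inr, List.count_cons, Finsupp.single_apply] using this
  rw [List.cons.injEq] at h₂
  obtain ⟨rfl, h₂⟩ := h₂
  obtain rfl : l = l' := Subtype.ext (eq_of_map_fst_snd h₁ h₂)
  rfl

variable (F : Type*) [Field F]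

theorem prod_alpha_hasLeadingMonomial (l : List (Fin n × Fin n)) (h : ∀ p ∈ l, p.1 < p.2) :
    HasLeadingMonomial (yWeight n) (l.map fun p => alpha F p.1 p.2).prod (listExp l) := by
  induction l with
  | nil => exact HasLeadingMonomial.one
  | cons p l ih =>
    simp only [List.mem_cons, forall_eq_or_imp] at h
    have := (alpha_hasLeadingMonomial F h.1).mul (ih h.2)
    simpa [listExp] using this

theorem stdMonomial_hasLeadingMonomial (l : StdIndex n) :
    HasLeadingMonomial (yWeight n) (stdMonomial F l) (listExp l.1) :=
  prod_alpha_hasLeadingMonomial F l.1 l.2.1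

theorem linearIndependent_stdMonomial :
    LinearIndependent F fun l : StdIndex n => stdMonomial F l :=
  linearIndependent_of_hasLeadingMonomial _ listExp_injective (stdMonomial_hasLeadingMonomial F)

theorem linearIndependent_stdMonomial_mul_Y :
    LinearIndependent F fun x : Σ j : Fin n, StdIndexGE j =>
      stdMonomial F x.2.1 * (MvPolynomial.X (Sum.inr x.1) : PolyA F n) :=
  linearIndependent_of_hasLeadingMonomial _ listExp_add_single_injective fun x =>
    (stdMonomial_hasLeadingMonomial F x.2.1).mul (HasLeadingMonomial.X _)

/-- The standard elements of `S_n + S_n V`. -/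
def stdElement : StdIndex n ⊕ (Σ j : Fin n, StdIndexGE j) → GammaOf (PolyA F n) :=
  Sum.elim (fun l => GammaExt.inEven F (detForm (PolyA F n)) (stdMonomial F l))
    (fun x => GammaExt.inEven F (detForm (PolyA F n)) (stdMonomial F x.2.1) * vGen F x.1)

theorem linearIndependent_stdElement : LinearIndependent F (stdElement F (n := n)) := by
  have h₂ : LinearIndependent F fun x : Σ j : Fin n, StdIndexGE j =>
      stdMonomial F x.2.1 • xy F x.1 :=
    -- The `y`-coordinate alone suffices: it sends `s v_j` to `s y_j`.
    LinearIndependent.of_comp (LinearMap.snd F (PolyA F n) (PolyA F n))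
      (linearIndependent_stdMonomial_mul_Y F)
  have h := linearIndependent_inl_union_inr' (linearIndependent_stdMonomial (n := n) F) h₂
  have e : stdElement F (n := n) =
      Sum.elim (LinearMap.inl F (PolyA F n) (PolyA F n × PolyA F n) ∘ stdMonomial F)
        (LinearMap.inr F (PolyA F n) (PolyA F n × PolyA F n) ∘ fun x => stdMonomial F x.2.1 •
          xy F x.1) := by
    funext x
    rcases x with l | x
    · rfl
    · exact GammaExt.inEven_mul_inOdd _ _
  rw [e]
  exact h

end StandardIndependent


/-! ### The generated subalgebra and the comparison map. -/

section Generated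

variable (F : Type*) [Field F] (n : ℕ)

theorem vGen_mul_vGen (i j : Fin n) : vGen F i * vGen F j =
    GammaExt.inEven F (detForm (PolyA F n)) (alpha F i j) := by
  rw [vGen, vGen, GammaExt.inOdd_mul_inOdd, detForm_apply]
  congr 1
  simp only [xy, alpha]
  ring

theorem vGen_mem_genSubalgebra (i : Fin n) : vGen F i ∈ genSubalgebra F n :=
  NonUnitalAlgebra.subset_adjoin F (Or.inr ⟨i, rfl⟩)

theorem one_mem_genSubalgebra : (1 : GammaOf (PolyA F n)) ∈ genSubalgebra F n :=
  NonUnitalAlgebra.subset_adjoin F (Or.inl rfl)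

theorem inEven_mem_genSubalgebra {a : PolyA F n} (ha : a ∈ pluckerAlg F n) :
    GammaExt.inEven F (detForm (PolyA F n)) a ∈ genSubalgebra F n := by
  induction ha using Algebra.adjoin_induction with
  | mem x h =>
    obtain ⟨i, j, -, rfl⟩ := h
    rw [← vGen_mul_vGen]
    exact mul_mem (vGen_mem_genSubalgebra F n i) (vGen_mem_genSubalgebra F n j)
  | algebraMap r =>
    rw [Algebra.algebraMap_eq_smul_one, map_smul, GammaExt.inEven_one]
    exact (genSubalgebra F n).smul_mem' r (one_mem_genSubalgebra F n)
  | add x y _ _ hx hy => rw [map_add]; exact add_mem hx hy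
  | mul x y _ _ hx hy => rw [GammaExt.inEven_mul]; exact mul_mem hx hy

theorem spaceS_sup_spaceSV_le : spaceS F n ⊔ spaceSV F n ≤ (genSubalgebra F n).toSubmodule := by
  have hS : spaceS F n ≤ (genSubalgebra F n).toSubmodule := by
    rintro _ ⟨a, ha, rfl⟩
    exact inEven_mem_genSubalgebra F n ha
  have hV : spaceV F n ≤ (genSubalgebra F n).toSubmodule := by
    refine Submodule.span_le.2 ?_
    rintro _ ⟨i, rfl⟩
    exact vGen_mem_genSubalgebra F n i
  refine sup_le hS (Submodule.span_le.2 ?_)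
  rintro _ ⟨s, hs, v, hv, rfl⟩
  exact (genSubalgebra F n).mul_mem' (hS hs) (hV hv)

theorem stdMonomial_mem_pluckerAlg (l : StdIndex n) : stdMonomial F l ∈ pluckerAlg F n := by
  refine list_prod_mem fun a ha => ?_
  obtain ⟨p, hp, rfl⟩ := List.mem_map.1 ha
  exact Algebra.subset_adjoin ⟨p.1, p.2, l.2.1 p hp, rfl⟩

theorem stdElement_mem (x : StdIndex n ⊕ (Σ j : Fin n, StdIndexGE j)) :
    stdElement F x ∈ spaceS F n ⊔ spaceSV F n := by
  rcases x with l | x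
  · exact Submodule.mem_sup_left ⟨_, stdMonomial_mem_pluckerAlg F n l, rfl⟩
  · exact Submodule.mem_sup_right (Submodule.subset_span
      ⟨_, ⟨_, stdMonomial_mem_pluckerAlg F n x.2.1, rfl⟩, _, Submodule.subset_span ⟨x.1, rfl⟩, rfl⟩)

variable {F n}

theorem map_inEven_pairProd {f : FreeGamma F (Fin n → F) →ₙₐ[F] GammaOf (PolyA F n)}
    (h1 : f 1 = 1) (hι : ∀ i, f (freeGammaι F (Fin n → F) (Pi.single i 1)) = vGen F i)
    (l : List (Fin n × Fin n)) :
    f (GammaExt.inEven F (grOddForm F (Fin n → F)) (pairProd (grPair F n) l)) =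
      GammaExt.inEven F (detForm (PolyA F n)) (l.map fun p => alpha F p.1 p.2).prod := by
  induction l with
  | nil => simpa [pairProd, GammaExt.inEven_one] using h1
  | cons p l ih =>
    rw [← Multiset.cons_coe, pairProd_cons, GammaExt.inEven_mul, map_mul, ih, grPair,
      ← freeGammaι_mul, map_mul, hι, hι, vGen_mul_vGen, ← GammaExt.inEven_mul, List.map_cons,
      List.prod_cons]

theorem map_freeStd {f : FreeGamma F (Fin n → F) →ₙₐ[F] GammaOf (PolyA F n)}
    (h1 : f 1 = 1) (hι : ∀ i, f (freeGammaι F (Fin n → F) (Pi.single i 1)) = vGen F i)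
    (x : StdIndex n ⊕ (Σ j : Fin n, StdIndexGE j)) : f (freeStd F n x) = stdElement F x := by
  rcases x with l | x
  · exact map_inEven_pairProd h1 hι l.1
  · change f (_ * _) = _ * _
    rw [map_mul, hι]
    exact congrArg (· * vGen F x.1) (map_inEven_pairProd h1 hι x.2.1.1)

end Generated

theorem theorem7 (F : Type u) [Field F] (n : ℕ) :
    -- `S_n + S_n V` is the (unital) subalgebra generated by `v_1, …, v_n`
    (genSubalgebra F n).toSubmodule = spaceS F n ⊔ spaceSV F n ∧
    -- `Γ[∅; V]`, `V = F^n`, is the free `Γ`-algebra on the space `V` of odd generators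
    IsFreeGammaAlgebra.{w}
      (GammaExt.evenPart F (grOddForm F (Fin n → F)))
      (GammaExt.oddPart F (grOddForm F (Fin n → F)))
      (freeGammaι F (Fin n → F)) ∧
    -- an isomorphism of `Γ[∅; V]` onto this subalgebra, as graded unital algebras, with `e_i ↦ v_i`
    (∃ φ : FreeGamma F (Fin n → F) ≃ₗ[F] genSubalgebra F n,
      (∀ a b, φ (a * b) = φ a * φ b) ∧
      ((φ 1 : genSubalgebra F n) : GammaOf (PolyA F n)) = 1 ∧
      (∀ i : Fin n, (φ (freeGammaι F (Fin n → F) (Pi.single i 1)) : GammaOf (PolyA F n)) =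
        vGen F i) ∧
      (∀ a ∈ GammaExt.evenPart F (grOddForm F (Fin n → F)),
        (φ a : GammaOf (PolyA F n)) ∈ GammaExt.evenPart F (detForm (PolyA F n))) ∧
      (∀ a ∈ GammaExt.oddPart F (grOddForm F (Fin n → F)),
        (φ a : GammaOf (PolyA F n)) ∈ GammaExt.oddPart F (detForm (PolyA F n)))) ∧
    -- the basis `B_n ∪ ⋃_j B_{n,j} v_j`
    (∃ b : Module.Basis (StdIndex n ⊕ (Σ j : Fin n, StdIndexGE j)) F (genSubalgebra F n),
      (∀ l : StdIndex n, (b (Sum.inl l) : GammaOf (PolyA F n)) =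
        GammaExt.inEven F (detForm (PolyA F n)) (stdMonomial F l)) ∧
      (∀ (j : Fin n) (l : StdIndexGE j), (b (Sum.inr ⟨j, l⟩) : GammaOf (PolyA F n)) =
        GammaExt.inEven F (detForm (PolyA F n)) (stdMonomial F l.1) * vGen F j)) := by
  -- The lifting lemma is applied directly, since the freeness statement concerns targets in the
  -- universe `w`, while `Γ(A_n)` lives in `u`.
  obtain ⟨f, h1, hφ, he, ho⟩ := (isGammaAlgebra_gammaOf F (PolyA F n)).exists_freeGamma_lift
    ((Pi.basisFun F (Fin n)).constr F (vGen F)) fun v => by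
      rw [Module.Basis.constr_apply_fintype]
      exact sum_mem fun i _ => Submodule.smul_mem _ _ ⟨_, rfl⟩
  have hι : ∀ i, f (freeGammaι F (Fin n → F) (Pi.single i 1)) = vGen F i := fun i => by
    rw [hφ, ← Pi.basisFun_apply, Module.Basis.constr_basis]
  have hstd := map_freeStd h1 hι
  have hle := spaceS_sup_spaceSV_le F n
  let fl : FreeGamma F (Fin n → F) →ₗ[F] GammaOf (PolyA F n) :=
    { toFun := f, map_add' := map_add f, map_smul' := map_smul f }
  have hcomp : fl ∘ freeStd F n = stdElement F := funext hstd
  let T : Module.Basis (StdIndex n ⊕ (Σ j : Fin n, StdIndexGE j)) F (FreeGamma F (Fin n → F)) :=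
    Module.Basis.mk (LinearIndependent.of_comp fl (hcomp ▸ linearIndependent_stdElement F))
      (span_freeStd F n).ge
  have hT : ⇑T = freeStd F n := Module.Basis.coe_mk _ _
  -- A linear map that takes a spanning family to an independent one is injective.
  have hinj : Function.Injective fl := LinearMap.injective_of_linearIndependent
    (span_freeStd F n) (hcomp ▸ linearIndependent_stdElement F)
  have hrange : LinearMap.range fl = Submodule.span F (Set.range (stdElement F)) := by
    rw [LinearMap.range_eq_map, ← span_freeStd, Submodule.map_span, ← Set.range_comp, hcomp]
  have hgen : (genSubalgebra F n).toSubmodule ≤ LinearMap.range fl := by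
    have : genSubalgebra F n ≤ NonUnitalAlgHom.range f := by
      refine NonUnitalAlgebra.adjoin_le ?_
      rintro _ (rfl | ⟨i, rfl⟩)
      · exact ⟨1, h1⟩
      · exact ⟨_, hι i⟩
    exact this
  have hspan : Submodule.span F (Set.range (stdElement F)) ≤ spaceS F n ⊔ spaceSV F n :=
    Submodule.span_le.2 (Set.range_subset_iff.2 (stdElement_mem F n))
  -- The inclusions close up into a cycle: range of `f` = span of the standard elements ≤ `S_n + S_n
  -- V` ≤ generated subalgebra ≤ range of `f`.
  have hrange' : LinearMap.range fl = (genSubalgebra F n).toSubmodule :=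
    le_antisymm (hrange.le.trans (hspan.trans hle)) hgen
  let φ : FreeGamma F (Fin n → F) ≃ₗ[F] genSubalgebra F n :=
    (LinearEquiv.ofInjective fl hinj).trans (LinearEquiv.ofEq _ _ hrange')
  have hφf : ∀ a, (φ a : GammaOf (PolyA F n)) = f a := fun a => rfl
  refine ⟨le_antisymm (hgen.trans (hrange.le.trans hspan)) hle,
    isFreeGammaAlgebra_freeGamma F (Fin n → F), ⟨φ, fun a b => Subtype.ext (map_mul f a b), h1, hι,
      he, ho⟩, T.map φ, fun l => ?_, fun j l => ?_⟩
  · rw [Module.Basis.map_apply, hφf, hT, hstd]; rfl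
  · rw [Module.Basis.map_apply, hφf, hT, hstd]; rfl

end
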